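/- Let $\mu_0\in\mathbb R$ and $\Upsilon\in\mathbb R\setminus\{0\}$. Let $\Omega\subseteq\{(t,r)\in\mathbb R^2: r\ge 0\}$ be relatively open and such that $(t,r)\in\Omega$ and $0\le s\le r$ imply $(t,s)\in\Omega$. Let $f:\Omega\to\mathbb C$ and $V,M:\Omega\to\mathbb R$ be twice continuously differentiable up to the centre $r=0$, with $2M(t,r)<r$ for $r>0$ and $M(t,0)=0$ for all $t$. Let $p=p(t,r)$ be complex valued. Consider the spherically symmetric metric $$g=-e^{2V}\,dt^2+\Big(1-\frac{2M}{r}\Big)^{-1}dr^2+r^2\,(d\theta^2+\sin^2\theta\,d\varphi^2)$$ on the chart $(t,r)\in\Omega$, $r>0$, $0<\theta<\pi$, $\varphi\in\mathbb R$, and let $G=\mathrm{Ric}-\tfrac12Rg$ be its Einstein tensor and $\Box_g$ its d'Alembertian. (a) The functions $(f,p,V,M)$ satisfy, at all points of $\Omega$ with $r>0$, the first-order system $$M_r=4\pi r^2\mu_0\Big(|f|^2+\Big(1-\frac{2M}{r}\Big)\frac{|f_r|^2+|p|^2}{\Upsilon^2}\Big),$$ $$V_r=\Big(1-\frac{2M}{r}\Big)^{-1}\Big(\frac{M}{r^2}-4\pi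 r\mu_0\Big(|f|^2-\Big(1-\frac{2M}{r}\Big)\frac{|f_r|^2+|p|^2}{\Upsilon^2}\Big)\Big),$$ $$f_t=p\,e^V\sqrt{1-\frac{2M}{r}},$$ $$p_t=e^V\Big(-\Upsilon^2f\Big(1-\frac{2M}{r}\Big)^{-1/2}+\frac{2f_r}{r}\sqrt{1-\frac{2M}{r}}\Big)+\partial_r\Big(e^Vf_r\sqrt{1-\frac{2M}{r}}\Big),$$ with $p$ continuously differentiable for $r>0$, if and only if $(f,g)$ solves the Einstein–Klein–Gordon equations $$G=8\pi\mu_0\Big(\frac{df\otimes d\bar f+d\bar f\otimes df}{\Upsilon^2}-\Big(\frac{|df|^2}{\Upsilon^2}+|f|^2\Big)g\Big),\qquad \Box_gf=\Upsilon^2f$$ on the chart and $p=f_t\,e^{-V}(1-2M/r)^{-1/2}$ for $r>0$. Here $|df|^2=g(df,d\bar f)$. (b) The equivalence holds with the same initial data on both sides. Let $(f_0,p_0,V_0,M_0)$ be consistent initial data on a slice $t=t_0$: regular functions of $r$ ($f_0,V_0,M_0$ of class $C^2$ up to $r=0$, and $p_0$ of class $C^1$ for $r>0$) with $M_0(0)=0$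 and $2M_0<r$ for $r>0$, satisfying the equations for $M_r$ and $V_r$ on that slice. Then $(f,p,V,M)$ solves the first-order system with $(f,p,V,M)|_{t=t_0}=(f_0,p_0,V_0,M_0)$ for $r>0$ if and only if $(f,g)$ solves the Einstein–Klein–Gordon equations with $f=f_0$, $f_t=p_0\,e^{V_0}\sqrt{1-2M_0/r}$, $V=V_0$, $M=M_0$ at $t=t_0$, $r>0$, and $p=f_t\,e^{-V}(1-2M/r)^{-1/2}$ for $r>0$. -/

import Mathlib

namespace SphericalEKG

noncomputable section

/-! ### Tensor calculus in a four-dimensional coordinate chart -/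

/-- Points of a coordinate chart; for the polar-areal chart the coordinates
`0, 1, 2, 3` are `t, r, θ, φ`. -/
abbrev Coord : Type := Fin 4 → ℝ

/-- The partial derivative of `h` with respect to the `i`-th coordinate. -/
def pderiv {E : Type*} [NormedAddCommGroup E] [NormedSpace ℝ E]
    (i : Fin 4) (h : Coord → E) (x : Coord) : E :=
  deriv (fun s : ℝ => h (Function.update x i s)) (x i)

/-- Christoffel symbols `Γᵢⱼᵏ = ½ gᵏᵐ (gⱼₘ,ᵢ + gᵢₘ,ⱼ - gᵢⱼ,ₘ)`. -/
def christoffel (g : Coord → Matrix (Fin 4) (Fin 4) ℝ) (i j k : Fin 4) (x : Coord) : ℝ :=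
  (1 / 2) * ∑ m, (g x)⁻¹ k m *
    (pderiv i (fun y => g y j m) x + pderiv j (fun y => g y i m) x
      - pderiv m (fun y => g y i j) x)

/-- Ricci tensor
`Ricᵢⱼ = Γᵢⱼᵏ,ₖ - Γₖⱼᵏ,ᵢ + Γᵢⱼˢ Γₖₛᵏ - Γₖⱼˢ Γᵢₛᵏ`. -/
def ricci (g : Coord → Matrix (Fin 4) (Fin 4) ℝ) (i j : Fin 4) (x : Coord) : ℝ :=
  ∑ k, (pderiv k (christoffel g i j k) x - pderiv i (christoffel g k j k) x
    + ∑ s, (christoffel g i j s x * christoffel g k s k x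
        - christoffel g k j s x * christoffel g i s k x))

/-- Scalar curvature `R = gⁱʲ Ricᵢⱼ`. -/
def scalarCurvature (g : Coord → Matrix (Fin 4) (Fin 4) ℝ) (x : Coord) : ℝ :=
  ∑ i, ∑ j, (g x)⁻¹ i j * ricci g i j x

/-- Einstein curvature tensor `G = Ric - ½ R g`. -/
def einstein (g : Coord → Matrix (Fin 4) (Fin 4) ℝ) (i j : Fin 4) (x : Coord) : ℝ :=
  ricci g i j x - (1 / 2) * scalarCurvature g x * g x i j

/-- The d'Alembertian `□_g f = |g|^(-1/2) ∂ᵢ (|g|^(1/2) gⁱʲ ∂ⱼ f)` of a complex function. -/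
def dalembertian (g : Coord → Matrix (Fin 4) (Fin 4) ℝ) (f : Coord → ℂ) (x : Coord) : ℂ :=
  (((Real.sqrt |(g x).det|)⁻¹ : ℝ) : ℂ) *
    ∑ i, pderiv i (fun y => ∑ j,
      ((Real.sqrt |(g y).det| * (g y)⁻¹ i j : ℝ) : ℂ) * pderiv j f y) x

/-- `|df|² = g(df, d f̄) = gⁱʲ ∂ᵢ f ∂ⱼ f̄`. -/
def normSqDifferential (g : Coord → Matrix (Fin 4) (Fin 4) ℝ) (f : Coord → ℂ)
    (x : Coord) : ℂ :=
  ∑ i, ∑ j, (((g x)⁻¹ i j : ℝ) : ℂ) * (pderiv i f x * starRingEnd ℂ (pderiv j f x))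

/-- Stress-energy tensor of a complex scalar field,
`T = μ₀ ((df ⊗ d f̄ + d f̄ ⊗ df) / Υ² - (|df|² / Υ² + |f|²) g)`. -/
def stressEnergy (μ₀ Υ : ℝ) (g : Coord → Matrix (Fin 4) (Fin 4) ℝ) (f : Coord → ℂ)
    (i j : Fin 4) (x : Coord) : ℂ :=
  (μ₀ : ℂ) *
    ((pderiv i f x * starRingEnd ℂ (pderiv j f x)
        + starRingEnd ℂ (pderiv i f x) * pderiv j f x) / (Υ : ℂ) ^ 2
      - (normSqDifferential g f x / (Υ : ℂ) ^ 2 + ((‖f x‖ ^ 2 : ℝ) : ℂ)) * ((g x i j : ℝ) : ℂ))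

/-- The Einstein-Klein-Gordon equations `G = 8π T`, `□_g f = Υ² f` at all points of `S`. -/
structure EinsteinKleinGordonOn (μ₀ Υ : ℝ) (g : Coord → Matrix (Fin 4) (Fin 4) ℝ)
    (f : Coord → ℂ) (S : Set Coord) : Prop where
  einstein_eq : ∀ x ∈ S, ∀ i j : Fin 4,
    ((einstein g i j x : ℝ) : ℂ) = 8 * (Real.pi : ℂ) * stressEnergy μ₀ Υ g f i j x
  kleinGordon_eq : ∀ x ∈ S, dalembertian g f x = (Υ : ℂ) ^ 2 * f x

/-! ### Spherical symmetry in polar-areal coordinates -/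

/-- The metric
`g = -e^{2V} dt² + (1 - 2M/r)⁻¹ dr² + r² (dθ² + sin² θ dφ²)`, with `V = V(t,r)`, `M = M(t,r)`. -/
def polarArealMetric (V M : ℝ → ℝ → ℝ) (x : Coord) : Matrix (Fin 4) (Fin 4) ℝ :=
  Matrix.diagonal
    ![-Real.exp (2 * V (x 0) (x 1)), (1 - 2 * M (x 0) (x 1) / x 1)⁻¹,
      (x 1) ^ 2, (x 1) ^ 2 * Real.sin (x 2) ^ 2]

/-- The spherically symmetric function on the chart given by a function of `(t, r)`. -/
def sphericalField (f : ℝ → ℝ → ℂ) (x : Coord) : ℂ := f (x 0) (x 1)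

/-- Admissible regions of the `(t, r)` half-plane `r ≥ 0`: relatively open, and each time slice
is an interval that starts at the centre `r = 0`
(for example `I ×ˢ Set.Ico 0 R` or `I ×ˢ Set.Ici 0` with `I` open). -/
structure IsRadialRegion (Ω : Set (ℝ × ℝ)) : Prop where
  relatively_open : ∃ U : Set (ℝ × ℝ), IsOpen U ∧ Ω = U ∩ {q | 0 ≤ q.2}
  reaches_center : ∀ t r s : ℝ, (t, r) ∈ Ω → 0 ≤ s → s ≤ r → (t, s) ∈ Ω

/-- The part of the polar-areal chart over `Ω`, without the coordinate singularities
`r = 0` and `θ = 0, π`. -/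
def polarChart (Ω : Set (ℝ × ℝ)) : Set Coord :=
  {x | (x 0, x 1) ∈ Ω ∧ 0 < x 1 ∧ 0 < x 2 ∧ x 2 < Real.pi}

/-- Standing assumptions on the scalar field and on the metric functions: twice continuously
differentiable up to the centre, `2M < r` away from the centre, and `M(t,0) = 0`. -/
structure IsAdmissible (Ω : Set (ℝ × ℝ)) (f : ℝ → ℝ → ℂ) (V M : ℝ → ℝ → ℝ) : Prop where
  f_contDiff : ContDiffOn ℝ 2 (Function.uncurry f) Ω
  V_contDiff : ContDiffOn ℝ 2 (Function.uncurry V) Ω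
  M_contDiff : ContDiffOn ℝ 2 (Function.uncurry M) Ω
  M_lt : ∀ t r : ℝ, (t, r) ∈ Ω → 0 < r → 2 * M t r < r
  M_center : ∀ t : ℝ, (t, 0) ∈ Ω → M t 0 = 0

/-- `p = f_t e^{-V} (1 - 2M/r)^{-1/2}` on `Ω`, away from the centre. -/
def IsMomentumOf (Ω : Set (ℝ × ℝ)) (f p : ℝ → ℝ → ℂ) (V M : ℝ → ℝ → ℝ) : Prop :=
  ∀ t r : ℝ, (t, r) ∈ Ω → 0 < r →
    p t r = deriv (fun s => f s r) t *
      ((Real.exp (-V t r) * (Real.sqrt (1 - 2 * M t r / r))⁻¹ : ℝ) : ℂ)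

/-- `(f, V, M)` solves the Einstein-Klein-Gordon equations. -/
def SolvesEKG (μ₀ Υ : ℝ) (Ω : Set (ℝ × ℝ)) (f : ℝ → ℝ → ℂ) (V M : ℝ → ℝ → ℝ) : Prop :=
  EinsteinKleinGordonOn μ₀ Υ (polarArealMetric V M) (sphericalField f) (polarChart Ω)

/-- The right-hand side of the equation for `M_r`, in terms of the values of
`f`, `f_r`, `p`, `M` at radius `r`. -/
def massRHS (μ₀ Υ r : ℝ) (f fr p : ℂ) (M : ℝ) : ℝ :=
  4 * Real.pi * r ^ 2 * μ₀ * (‖f‖ ^ 2 + (1 - 2 * M / r) * ((‖fr‖ ^ 2 + ‖p‖ ^ 2) / Υ ^ 2))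

/-- The right-hand side of the equation for `V_r`, in terms of the values of
`f`, `f_r`, `p`, `M` at radius `r`. -/
def potentialRHS (μ₀ Υ r : ℝ) (f fr p : ℂ) (M : ℝ) : ℝ :=
  (1 - 2 * M / r)⁻¹ * (M / r ^ 2 - 4 * Real.pi * r * μ₀ *
    (‖f‖ ^ 2 - (1 - 2 * M / r) * ((‖fr‖ ^ 2 + ‖p‖ ^ 2) / Υ ^ 2)))

/-- `(f, p, V, M)` solves the first-order system on `Ω`, away from the centre. -/
structure SolvesSystem (μ₀ Υ : ℝ) (Ω : Set (ℝ × ℝ)) (f p : ℝ → ℝ → ℂ) (V M : ℝ → ℝ → ℝ) :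
    Prop where
  p_contDiff : ContDiffOn ℝ 1 (Function.uncurry p) (Ω ∩ {q | 0 < q.2})
  mass_eq : ∀ t r : ℝ, (t, r) ∈ Ω → 0 < r →
    deriv (fun s => M t s) r =
      massRHS μ₀ Υ r (f t r) (deriv (fun s => f t s) r) (p t r) (M t r)
  potential_eq : ∀ t r : ℝ, (t, r) ∈ Ω → 0 < r →
    deriv (fun s => V t s) r =
      potentialRHS μ₀ Υ r (f t r) (deriv (fun s => f t s) r) (p t r) (M t r)
  f_evolution : ∀ t r : ℝ, (t, r) ∈ Ω → 0 < r →
    deriv (fun s => f s r) t =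
      p t r * ((Real.exp (V t r) * Real.sqrt (1 - 2 * M t r / r) : ℝ) : ℂ)
  p_evolution : ∀ t r : ℝ, (t, r) ∈ Ω → 0 < r →
    deriv (fun s => p s r) t =
      ((Real.exp (V t r) : ℝ) : ℂ) *
        (-(Υ : ℂ) ^ 2 * f t r * (((Real.sqrt (1 - 2 * M t r / r))⁻¹ : ℝ) : ℂ)
          + 2 * deriv (fun s => f t s) r / (r : ℂ)
            * ((Real.sqrt (1 - 2 * M t r / r) : ℝ) : ℂ))
      + deriv (fun s => ((Real.exp (V t s) : ℝ) : ℂ) * deriv (fun u => f t u) s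
          * ((Real.sqrt (1 - 2 * M t s / s) : ℝ) : ℂ)) r

/-! ### Initial data -/

/-- Initial values, as functions of `r`, for `f`, `p`, `V` and `M`. -/
structure InitialData where
  f₀ : ℝ → ℂ
  p₀ : ℝ → ℂ
  V₀ : ℝ → ℝ
  M₀ : ℝ → ℝ

/-- Consistent initial data on the slice `t = t₀`: regular data for which `M₀` vanishes at the
centre, `2 M₀ < r`, and the two radial equations of the system hold on the slice. -/
structure InitialData.IsConsistent (D : InitialData) (μ₀ Υ : ℝ) (Ω : Set (ℝ × ℝ)) (t₀ : ℝ) :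
    Prop where
  f_contDiff : ContDiffOn ℝ 2 D.f₀ {r | (t₀, r) ∈ Ω}
  p_contDiff : ContDiffOn ℝ 1 D.p₀ {r | (t₀, r) ∈ Ω ∧ 0 < r}
  V_contDiff : ContDiffOn ℝ 2 D.V₀ {r | (t₀, r) ∈ Ω}
  M_contDiff : ContDiffOn ℝ 2 D.M₀ {r | (t₀, r) ∈ Ω}
  M_center : D.M₀ 0 = 0
  M_lt : ∀ r : ℝ, (t₀, r) ∈ Ω → 0 < r → 2 * D.M₀ r < r
  mass_eq : ∀ r : ℝ, (t₀, r) ∈ Ω → 0 < r →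
    deriv D.M₀ r = massRHS μ₀ Υ r (D.f₀ r) (deriv D.f₀ r) (D.p₀ r) (D.M₀ r)
  potential_eq : ∀ r : ℝ, (t₀, r) ∈ Ω → 0 < r →
    deriv D.V₀ r = potentialRHS μ₀ Υ r (D.f₀ r) (deriv D.f₀ r) (D.p₀ r) (D.M₀ r)

/-- `(f, p, V, M)` takes the initial values `D` at `t = t₀`. -/
def InitialData.AttainedBy (D : InitialData) (Ω : Set (ℝ × ℝ)) (t₀ : ℝ)
    (f p : ℝ → ℝ → ℂ) (V M : ℝ → ℝ → ℝ) : Prop :=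
  ∀ r : ℝ, (t₀, r) ∈ Ω → 0 < r →
    f t₀ r = D.f₀ r ∧ p t₀ r = D.p₀ r ∧ V t₀ r = D.V₀ r ∧ M t₀ r = D.M₀ r

/-- `(f, V, M)` takes the Cauchy data determined by `D` at `t = t₀`:
`f = f₀`, `f_t = p₀ e^{V₀} (1 - 2M₀/r)^{1/2}`, `V = V₀`, `M = M₀`. -/
def InitialData.CauchyAttainedBy (D : InitialData) (Ω : Set (ℝ × ℝ)) (t₀ : ℝ)
    (f : ℝ → ℝ → ℂ) (V M : ℝ → ℝ → ℝ) : Prop :=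
  ∀ r : ℝ, (t₀, r) ∈ Ω → 0 < r →
    f t₀ r = D.f₀ r ∧
    deriv (fun s => f s r) t₀ =
      D.p₀ r * ((Real.exp (D.V₀ r) * Real.sqrt (1 - 2 * D.M₀ r / r) : ℝ) : ℂ) ∧
    V t₀ r = D.V₀ r ∧ M t₀ r = D.M₀ r

end

end SphericalEKG

/-! Write `(1 - 2M/r)⁻¹ = e^{2L}` and `k = 4πμ₀/Υ²`. For a spherically symmetric field the Einstein
equations have only the components tt, rr, tr, θθ and φφ. The tt and rr components are first order
and are the equations for `M_r` and `V_r` in disguise. The tr component is the momentum constraint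
`L_t = 2 k r Re(f_t f̄_r)`. The Klein–Gordon equation is the evolution equation for `p`, once `p` is
read as `f_t e^{L-V}`. The system is thus equivalent to the reduced equations (tt, rr, wave)
together with this reading of `p` (`IsAdmissible.solvesSystem_iff`).

Given the reduced equations and the momentum constraint, the θθ and φφ components come for free, as
the contracted Bianchi identity predicts. Here this is checked by differentiating the lower-order
equations (`SolvesReduced.angular_eq`). Hence Einstein–Klein–Gordon is the reduced equations plus
the momentum constraint (`IsAdmissible.solvesEKG_iff`).

It remains to derive the constraint from the reduced equations (`IsAdmissible.momentumConstraint`).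
Comparing `L_rt` with `L_tr` shows that `r e^{V-L}` times the constraint defect does not depend on
`r` (`SolvesReduced.hasDerivAt_momentum_defect`). Regularity at the centre makes this constant zero:
`r e^{V-L} L_t = e^{V+L} M_t`, where `M_t → 0` because `M(t,0) = 0`, and `e^L → 1` because the mass
equation forces `M/r → 0`.

Part (b) adds only a pointwise translation of the data on one slice. The field is split into real
and imaginary parts so that the main identities become rational identities between real numbers. -/

namespace SphericalEKG

open Filter Topology Set

/-! ### Partial derivatives of functions of `(t, r)` -/

section Calculus

variable {E : Type*} [NormedAddCommGroup E] [NormedSpace ℝ E]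

/-- The partial derivative with respect to `t`. -/
noncomputable def dt (F : ℝ → ℝ → E) (t r : ℝ) : E := deriv (fun s => F s r) t

/-- The partial derivative with respect to `r`. -/
noncomputable def dr (F : ℝ → ℝ → E) (t r : ℝ) : E := deriv (fun s => F t s) r

theorem hasDerivAt_prod_fst (t r : ℝ) :
    HasDerivAt (fun s : ℝ => ((s, r) : ℝ × ℝ)) (1, 0) t :=
  (hasDerivAt_id t).prodMk (hasDerivAt_const t r)

theorem hasDerivAt_prod_snd (t r : ℝ) :
    HasDerivAt (fun s : ℝ => ((t, s) : ℝ × ℝ)) (0, 1) r :=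
  (hasDerivAt_const r t).prodMk (hasDerivAt_id r)

theorem dt_eq_fderiv {F : ℝ → ℝ → E} {t r : ℝ}
    (h : DifferentiableAt ℝ (Function.uncurry F) (t, r)) :
    dt F t r = fderiv ℝ (Function.uncurry F) (t, r) (1, 0) :=
  have hd : HasDerivAt (fun s => F s r) (fderiv ℝ (Function.uncurry F) (t, r) (1, 0)) t :=
    HasFDerivAt.comp_hasDerivAt (l := Function.uncurry F) (f := fun s => (s, r)) t h.hasFDerivAt
      (hasDerivAt_prod_fst t r)
  hd.deriv

theorem dr_eq_fderiv {F : ℝ → ℝ → E} {t r : ℝ}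
    (h : DifferentiableAt ℝ (Function.uncurry F) (t, r)) :
    dr F t r = fderiv ℝ (Function.uncurry F) (t, r) (0, 1) :=
  have hd : HasDerivAt (fun s => F t s) (fderiv ℝ (Function.uncurry F) (t, r) (0, 1)) r :=
    h.hasFDerivAt.comp_hasDerivAt r (hasDerivAt_prod_snd t r)
  hd.deriv

theorem hasDerivAt_dt {F : ℝ → ℝ → E} {O : Set (ℝ × ℝ)} (hO : IsOpen O)
    (hF : ContDiffOn ℝ 1 (Function.uncurry F) O) {t r : ℝ} (h : (t, r) ∈ O) :
    HasDerivAt (fun s => F s r) (dt F t r) t := by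
  have hd := (hF.contDiffAt (hO.mem_nhds h)).differentiableAt one_ne_zero
  rw [dt_eq_fderiv hd]
  exact hd.hasFDerivAt.comp_hasDerivAt t (hasDerivAt_prod_fst t r)

theorem hasDerivAt_dr {F : ℝ → ℝ → E} {O : Set (ℝ × ℝ)} (hO : IsOpen O)
    (hF : ContDiffOn ℝ 1 (Function.uncurry F) O) {t r : ℝ} (h : (t, r) ∈ O) :
    HasDerivAt (fun s => F t s) (dr F t r) r := by
  have hd := (hF.contDiffAt (hO.mem_nhds h)).differentiableAt one_ne_zero
  rw [dr_eq_fderiv hd]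
  exact hd.hasFDerivAt.comp_hasDerivAt r (hasDerivAt_prod_snd t r)

theorem contDiffOn_dt {F : ℝ → ℝ → E} {O : Set (ℝ × ℝ)} (hO : IsOpen O)
    (hF : ContDiffOn ℝ 2 (Function.uncurry F) O) :
    ContDiffOn ℝ 1 (Function.uncurry (dt F)) O := by
  have h1 : ContDiffOn ℝ 1 (fun q => fderiv ℝ (Function.uncurry F) q (1, 0)) O :=
    (hF.fderiv_of_isOpen hO (m := 1) (by norm_num)).clm_apply contDiffOn_const
  exact h1.congr fun q hq =>
    dt_eq_fderiv ((hF.contDiffAt (hO.mem_nhds hq)).differentiableAt two_ne_zero)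

theorem contDiffOn_dr {F : ℝ → ℝ → E} {O : Set (ℝ × ℝ)} (hO : IsOpen O)
    (hF : ContDiffOn ℝ 2 (Function.uncurry F) O) :
    ContDiffOn ℝ 1 (Function.uncurry (dr F)) O := by
  have h1 : ContDiffOn ℝ 1 (fun q => fderiv ℝ (Function.uncurry F) q (0, 1)) O :=
    (hF.fderiv_of_isOpen hO (m := 1) (by norm_num)).clm_apply contDiffOn_const
  exact h1.congr fun q hq =>
    dr_eq_fderiv ((hF.contDiffAt (hO.mem_nhds hq)).differentiableAt two_ne_zero)

theorem hasFDerivAt_clm_apply {X : Type*} [NormedAddCommGroup X] [NormedSpace ℝ X]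
    {G : X → X →L[ℝ] E} {q : X} (hG : DifferentiableAt ℝ G q) (v : X) :
    HasFDerivAt (fun y => G y v) ((ContinuousLinearMap.apply ℝ E v).comp (fderiv ℝ G q)) q :=
  (ContinuousLinearMap.apply ℝ E v).hasFDerivAt.comp q hG.hasFDerivAt

/-- Symmetry of the second derivative. Applied to `L`, it is what links the mass equation to the
momentum constraint. -/
theorem dr_dt_eq_dt_dr {F : ℝ → ℝ → E} {O : Set (ℝ × ℝ)} (hO : IsOpen O)
    (hF : ContDiffOn ℝ 2 (Function.uncurry F) O) {t r : ℝ} (h : (t, r) ∈ O) :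
    dr (dt F) t r = dt (dr F) t r := by
  have hc := hF.contDiffAt (hO.mem_nhds h)
  have hf : DifferentiableAt ℝ (fderiv ℝ (Function.uncurry F)) (t, r) :=
    (hc.fderiv_right (m := 1) (by norm_num)).differentiableAt one_ne_zero
  have hsymm := hc.isSymmSndFDerivAt (by simp)
  have hev : ∀ᶠ q in 𝓝 (t, r), DifferentiableAt ℝ (Function.uncurry F) q := by
    filter_upwards [hO.mem_nhds h] with q hq
    exact (hF.contDiffAt (hO.mem_nhds hq)).differentiableAt two_ne_zero
  have h1 : dr (dt F) t r = fderiv ℝ (fderiv ℝ (Function.uncurry F)) (t, r) (0, 1) (1, 0) := by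
    have hd := (hasFDerivAt_clm_apply hf (1, 0)).comp_hasDerivAt r (hasDerivAt_prod_snd t r)
    refine (hd.congr_of_eventuallyEq ?_).deriv
    filter_upwards [(hasDerivAt_prod_snd t r).continuousAt.eventually hev] with s hs
    exact dt_eq_fderiv hs
  have h2 : dt (dr F) t r = fderiv ℝ (fderiv ℝ (Function.uncurry F)) (t, r) (1, 0) (0, 1) := by
    have hd := (hasFDerivAt_clm_apply hf (0, 1)).comp_hasDerivAt t (hasDerivAt_prod_fst t r)
    refine (hd.congr_of_eventuallyEq ?_).deriv
    filter_upwards [(hasDerivAt_prod_fst t r).continuousAt.eventually hev] with s hs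
    exact dr_eq_fderiv hs
  rw [h1, h2, hsymm.eq]

theorem eventually_mem_fst {O : Set (ℝ × ℝ)} (hO : IsOpen O) {t r : ℝ} (h : (t, r) ∈ O) :
    ∀ᶠ s in 𝓝 t, (s, r) ∈ O :=
  (hasDerivAt_prod_fst t r).continuousAt.eventually (hO.mem_nhds h)

theorem eventually_mem_snd {O : Set (ℝ × ℝ)} (hO : IsOpen O) {t r : ℝ} (h : (t, r) ∈ O) :
    ∀ᶠ s in 𝓝 r, (t, s) ∈ O :=
  (hasDerivAt_prod_snd t r).continuousAt.eventually (hO.mem_nhds h)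

end Calculus

/-! ### Curvature of diagonal spherically symmetric metrics -/

theorem polarChart_isOpen {Ω : Set (ℝ × ℝ)} (hU : IsOpen (Ω ∩ {q | 0 < q.2})) :
    IsOpen (polarChart Ω) := by
  have h : polarChart Ω = (fun x : Coord => (x 0, x 1)) ⁻¹' (Ω ∩ {q | 0 < q.2})
      ∩ ({x | 0 < x 2} ∩ {x | x 2 < Real.pi}) := by
    ext x
    simp [polarChart, and_assoc]
  rw [h]
  refine (hU.preimage (by fun_prop)).inter
    ((isOpen_lt continuous_const (continuous_apply 2)).inter
      (isOpen_lt (continuous_apply 2) continuous_const))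

/-- Closed forms for the metric and the connection hold only on the chart. Its openness is what
allows them to be differentiated there. -/
theorem pderiv_congr {E : Type*} [NormedAddCommGroup E] [NormedSpace ℝ E] {S : Set Coord}
    (hS : IsOpen S) {F G : Coord → E} (h : EqOn F G S) (i : Fin 4) {x : Coord} (hx : x ∈ S) :
    pderiv i F x = pderiv i G x := by
  refine EventuallyEq.deriv_eq ?_
  have hc : ContinuousAt (fun s : ℝ => Function.update x i s) (x i) := by fun_prop
  have hm : ∀ᶠ y in 𝓝 (Function.update x i (x i)), y ∈ S := by
    rw [Function.update_eq_self]
    exact hS.mem_nhds hx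
  filter_upwards [hc.eventually hm] with s hs
  exact h hs

section Pderiv

variable {E : Type*} [NormedAddCommGroup E] [NormedSpace ℝ E] (φ : ℝ → ℝ → ℝ → E) (x : Coord)

theorem pderiv_zero :
    pderiv 0 (fun y => φ (y 0) (y 1) (y 2)) x = deriv (fun s => φ s (x 1) (x 2)) (x 0) := by
  simp [pderiv, Function.update]

theorem pderiv_one :
    pderiv 1 (fun y => φ (y 0) (y 1) (y 2)) x = deriv (fun s => φ (x 0) s (x 2)) (x 1) := by
  simp [pderiv, Function.update]

theorem pderiv_two :
    pderiv 2 (fun y => φ (y 0) (y 1) (y 2)) x = deriv (fun s => φ (x 0) (x 1) s) (x 2) := by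
  simp [pderiv, Function.update]

theorem pderiv_three :
    pderiv 3 (fun y => φ (y 0) (y 1) (y 2)) x = 0 := by
  simp [pderiv, Function.update]

end Pderiv

/-- The pattern of Christoffel symbols of a spherically symmetric diagonal metric. -/
def connTable (c : Fin 11 → ℝ) (i j k : Fin 4) : ℝ :=
  (![![![c 0, c 3, 0, 0], ![c 1, c 4, 0, 0], ![0, 0, 0, 0], ![0, 0, 0, 0]],
    ![![c 1, c 4, 0, 0], ![c 2, c 5, 0, 0], ![0, 0, c 8, 0], ![0, 0, 0, c 8]],
    ![![0, 0, 0, 0], ![0, 0, c 8, 0], ![0, c 6, 0, 0], ![0, 0, 0, c 10]],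
    ![![0, 0, 0, 0], ![0, 0, 0, c 8], ![0, 0, 0, c 10], ![0, c 7, c 9, 0]]] :
      Fin 4 → Fin 4 → Fin 4 → ℝ) i j k

/-- Each entry of the table is zero or a coordinate of `c`, so differentiating the connection
reduces to eleven scalar derivatives. -/
theorem hasDerivAt_connTable {c : ℝ → Fin 11 → ℝ} {c' : Fin 11 → ℝ} {s : ℝ}
    (h : HasDerivAt c c' s) (i j k : Fin 4) :
    HasDerivAt (fun u => connTable (c u) i j k) (connTable c' i j k) s := by
  have h' := hasDerivAt_pi.1 h
  have h0 := hasDerivAt_const s (0 : ℝ)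
  fin_cases i <;> fin_cases j <;> fin_cases k <;> first | exact h0 | exact h' _

/-- The coefficients of the connection of
`-e^{2V} dt² + e^{2L} dr² + r² (dθ² + sin² θ dφ²)`. -/
noncomputable def connCoeff (V L : ℝ → ℝ → ℝ) (t r θ : ℝ) : Fin 11 → ℝ :=
  ![dt V t r, dr V t r, dt L t r * Real.exp (2 * (L t r - V t r)),
    dr V t r * Real.exp (2 * (V t r - L t r)), dt L t r, dr L t r,
    -(r * Real.exp (-2 * L t r)), -(r * Real.exp (-2 * L t r)) * Real.sin θ ^ 2, r⁻¹,
    -(Real.sin θ * Real.cos θ), Real.cos θ / Real.sin θ]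

/-- The diagonal of `-e^{2V} dt² + e^{2L} dr² + r² (dθ² + sin² θ dφ²)`. -/
noncomputable def metricDiag (V L : ℝ → ℝ → ℝ) (t r θ : ℝ) : Fin 4 → ℝ :=
  ![-Real.exp (2 * V t r), Real.exp (2 * L t r), r ^ 2, r ^ 2 * Real.sin θ ^ 2]

/-- The metric `-e^{2V} dt² + e^{2L} dr² + r² (dθ² + sin² θ dφ²)`. -/
noncomputable def expMetric (V L : ℝ → ℝ → ℝ) (x : Coord) : Matrix (Fin 4) (Fin 4) ℝ :=
  Matrix.diagonal (metricDiag V L (x 0) (x 1) (x 2))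

theorem metricDiag_ne_zero (V L : ℝ → ℝ → ℝ) {t r θ : ℝ} (hr : r ≠ 0) (hθ : Real.sin θ ≠ 0)
    (i : Fin 4) : metricDiag V L t r θ i ≠ 0 := by
  fin_cases i <;> simp [metricDiag, hr, hθ, Real.exp_ne_zero]

theorem inv_diagonal_apply {d : Fin 4 → ℝ} (hd : ∀ i, d i ≠ 0) (i j : Fin 4) :
    (Matrix.diagonal d)⁻¹ i j = if i = j then (d i)⁻¹ else 0 := by
  have h : (Matrix.diagonal d)⁻¹ = Matrix.diagonal (fun i => (d i)⁻¹) := by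
    apply Matrix.inv_eq_right_inv
    rw [Matrix.diagonal_mul_diagonal, ← Matrix.diagonal_one]
    congr 1
    funext i
    exact mul_inv_cancel₀ (hd i)
  rw [h, Matrix.diagonal_apply]

/-- The partial derivatives of the diagonal metric coefficients. -/
noncomputable def metricDeriv (V L : ℝ → ℝ → ℝ) (t r θ : ℝ) : Fin 4 → Fin 4 → ℝ :=
  ![![-(2 * dt V t r * Real.exp (2 * V t r)), 2 * dt L t r * Real.exp (2 * L t r), 0, 0],
    ![-(2 * dr V t r * Real.exp (2 * V t r)), 2 * dr L t r * Real.exp (2 * L t r), 2 * r,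
      2 * r * Real.sin θ ^ 2],
    ![0, 0, 0, r ^ 2 * (2 * Real.sin θ * Real.cos θ)],
    ![0, 0, 0, 0]]

section Curvature

variable {O : Set (ℝ × ℝ)} {V L : ℝ → ℝ → ℝ}

theorem pderiv_metricDiag (hO : IsOpen O) (hV : ContDiffOn ℝ 1 (Function.uncurry V) O)
    (hL : ContDiffOn ℝ 1 (Function.uncurry L) O) {x : Coord} (hx : (x 0, x 1) ∈ O)
    (i j : Fin 4) :
    pderiv i (fun y => metricDiag V L (y 0) (y 1) (y 2) j) x
      = metricDeriv V L (x 0) (x 1) (x 2) i j := by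
  have hVt := hasDerivAt_dt hO hV hx
  have hVr := hasDerivAt_dr hO hV hx
  have hLt := hasDerivAt_dt hO hL hx
  have hLr := hasDerivAt_dr hO hL hx
  have h1 : ∀ {F : ℝ → ℝ} {F' s : ℝ}, HasDerivAt F F' s →
      HasDerivAt (fun u => Real.exp (2 * F u)) (2 * F' * Real.exp (2 * F s)) s := by
    intro F F' s h
    have := (h.const_mul 2).exp
    rwa [mul_comm] at this
  have h2 : HasDerivAt (fun u : ℝ => u ^ 2) (2 * x 1) (x 1) := by
    simpa using hasDerivAt_pow 2 (x 1)
  have h3 : HasDerivAt (fun u : ℝ => Real.sin u ^ 2) (2 * Real.sin (x 2) * Real.cos (x 2))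
      (x 2) := by
    simpa using (Real.hasDerivAt_sin (x 2)).fun_pow 2
  have key : ∀ i : Fin 4, pderiv i (fun y => metricDiag V L (y 0) (y 1) (y 2) j) x =
      ![deriv (fun s => metricDiag V L s (x 1) (x 2) j) (x 0),
        deriv (fun s => metricDiag V L (x 0) s (x 2) j) (x 1),
        deriv (fun s => metricDiag V L (x 0) (x 1) s j) (x 2), 0] i := by
    intro i
    fin_cases i
    · exact pderiv_zero (fun t r θ => metricDiag V L t r θ j) x
    · exact pderiv_one (fun t r θ => metricDiag V L t r θ j) x
    · exact pderiv_two (fun t r θ => metricDiag V L t r θ j) x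
    · exact pderiv_three (fun t r θ => metricDiag V L t r θ j) x
  rw [key]
  have hc : ∀ a s : ℝ, deriv (fun _ : ℝ => a) s = 0 := fun a s => deriv_const s a
  fin_cases i <;> fin_cases j
  · exact (h1 hVt).fun_neg.deriv
  · exact (h1 hLt).deriv
  · exact hc _ _
  · exact hc _ _
  · exact (h1 hVr).fun_neg.deriv
  · exact (h1 hLr).deriv
  · exact h2.deriv
  · exact (h2.mul_const _).deriv
  · exact hc _ _
  · exact hc _ _
  · exact hc _ _
  · exact (h3.const_mul _).deriv
  · rfl
  · rfl
  · rfl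
  · rfl

theorem christoffel_expMetric (hO : IsOpen O) (hV : ContDiffOn ℝ 1 (Function.uncurry V) O)
    (hL : ContDiffOn ℝ 1 (Function.uncurry L) O) {x : Coord} (hx : (x 0, x 1) ∈ O)
    (hr : x 1 ≠ 0) (hθ : Real.sin (x 2) ≠ 0) (i j k : Fin 4) :
    christoffel (expMetric V L) i j k x = connTable (connCoeff V L (x 0) (x 1) (x 2)) i j k := by
  have hp : ∀ a b m : Fin 4, pderiv a (fun y => expMetric V L y b m) x
      = if b = m then metricDeriv V L (x 0) (x 1) (x 2) a b else 0 := by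
    intro a b m
    by_cases hbm : b = m
    · subst hbm
      rw [if_pos rfl, ← pderiv_metricDiag hO hV hL hx]
      simp only [expMetric, Matrix.diagonal_apply_eq]
    · rw [if_neg hbm]
      simp only [expMetric, Matrix.diagonal_apply_ne _ hbm]
      simp [pderiv]
  have hd := metricDiag_ne_zero V L (t := x 0) hr hθ
  have hi : ∀ m, (expMetric V L x)⁻¹ k m
      = if k = m then (metricDiag V L (x 0) (x 1) (x 2) k)⁻¹ else 0 :=
    fun m => inv_diagonal_apply hd k m
  simp only [christoffel, hp, hi, ite_mul, zero_mul, Finset.sum_ite_eq, Finset.mem_univ, if_true]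
  -- All exponentials are expressed through the two atoms `e^{2L}` and `e^{2V}`, so that each
  -- component becomes a rational identity.
  have e1 : Real.exp (2 * (L (x 0) (x 1) - V (x 0) (x 1)))
      = Real.exp (2 * L (x 0) (x 1)) / Real.exp (2 * V (x 0) (x 1)) := by
    rw [← Real.exp_sub]; ring_nf
  have e2 : Real.exp (2 * (V (x 0) (x 1) - L (x 0) (x 1)))
      = Real.exp (2 * V (x 0) (x 1)) / Real.exp (2 * L (x 0) (x 1)) := by
    rw [← Real.exp_sub]; ring_nf
  have e3 : Real.exp (-(2 * L (x 0) (x 1))) = (Real.exp (2 * L (x 0) (x 1)))⁻¹ := by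
    rw [← Real.exp_neg]
  have n1 := Real.exp_ne_zero (2 * L (x 0) (x 1))
  have n2 := Real.exp_ne_zero (2 * V (x 0) (x 1))
  fin_cases i <;> fin_cases j <;> fin_cases k <;>
    simp [connTable, connCoeff, metricDeriv, metricDiag, e1, e2, e3] <;> field_simp

end Curvature

/-! ### Derivatives of the connection and the Ricci tensor -/

section Curvature

variable {O : Set (ℝ × ℝ)} {V L : ℝ → ℝ → ℝ}

/-- The partial derivatives of the connection coefficients `connCoeff`. -/
noncomputable def connDeriv (V L : ℝ → ℝ → ℝ) (t r θ : ℝ) : Fin 4 → Fin 11 → ℝ :=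
  ![![dt (dt V) t r, dr (dt V) t r,
      dt (dt L) t r * Real.exp (2 * (L t r - V t r))
        + dt L t r * (Real.exp (2 * (L t r - V t r)) * (2 * (dt L t r - dt V t r))),
      dr (dt V) t r * Real.exp (2 * (V t r - L t r))
        + dr V t r * (Real.exp (2 * (V t r - L t r)) * (2 * (dt V t r - dt L t r))),
      dt (dt L) t r, dr (dt L) t r,
      -(r * (Real.exp (-2 * L t r) * (-2 * dt L t r))),
      -(r * (Real.exp (-2 * L t r) * (-2 * dt L t r))) * Real.sin θ ^ 2, 0, 0, 0],
    ![dr (dt V) t r, dr (dr V) t r,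
      dr (dt L) t r * Real.exp (2 * (L t r - V t r))
        + dt L t r * (Real.exp (2 * (L t r - V t r)) * (2 * (dr L t r - dr V t r))),
      dr (dr V) t r * Real.exp (2 * (V t r - L t r))
        + dr V t r * (Real.exp (2 * (V t r - L t r)) * (2 * (dr V t r - dr L t r))),
      dr (dt L) t r, dr (dr L) t r,
      -(1 * Real.exp (-2 * L t r) + r * (Real.exp (-2 * L t r) * (-2 * dr L t r))),
      -(1 * Real.exp (-2 * L t r) + r * (Real.exp (-2 * L t r) * (-2 * dr L t r)))
        * Real.sin θ ^ 2, -(r ^ 2)⁻¹, 0, 0],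
    ![0, 0, 0, 0, 0, 0, 0,
      -(r * Real.exp (-2 * L t r)) * (2 * Real.sin θ * Real.cos θ), 0,
      -(Real.cos θ * Real.cos θ + Real.sin θ * -Real.sin θ),
      (-Real.sin θ * Real.sin θ - Real.cos θ * Real.cos θ) / Real.sin θ ^ 2],
    0]

theorem pderiv_christoffel_expMetric (hO : IsOpen O) (hV : ContDiffOn ℝ 2 (Function.uncurry V) O)
    (hL : ContDiffOn ℝ 2 (Function.uncurry L) O) {x : Coord} (hx : (x 0, x 1) ∈ O)
    (hr : x 1 ≠ 0) (hθ : Real.sin (x 2) ≠ 0) (l i j k : Fin 4) :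
    pderiv l (fun y => connTable (connCoeff V L (y 0) (y 1) (y 2)) i j k) x
      = connTable (connDeriv V L (x 0) (x 1) (x 2) l) i j k := by
  have hV1 := hV.of_le one_le_two
  have hL1 := hL.of_le one_le_two
  have hVt := hasDerivAt_dt hO hV1 hx
  have hVr := hasDerivAt_dr hO hV1 hx
  have hLt := hasDerivAt_dt hO hL1 hx
  have hLr := hasDerivAt_dr hO hL1 hx
  have hVtt := hasDerivAt_dt hO (contDiffOn_dt hO hV) hx
  have hVtr := hasDerivAt_dr hO (contDiffOn_dt hO hV) hx
  have hVrt := hasDerivAt_dt hO (contDiffOn_dr hO hV) hx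
  have hVrr := hasDerivAt_dr hO (contDiffOn_dr hO hV) hx
  have hLtt := hasDerivAt_dt hO (contDiffOn_dt hO hL) hx
  have hLtr := hasDerivAt_dr hO (contDiffOn_dt hO hL) hx
  have hLrt := hasDerivAt_dt hO (contDiffOn_dr hO hL) hx
  have hLrr := hasDerivAt_dr hO (contDiffOn_dr hO hL) hx
  -- `connDeriv` records every mixed derivative in the order `dr (dt ·)`.
  rw [← dr_dt_eq_dt_dr hO hV hx] at hVrt
  rw [← dr_dt_eq_dt_dr hO hL hx] at hLrt
  have hc : ∀ a s : ℝ, HasDerivAt (fun _ : ℝ => a) 0 s := fun a s => hasDerivAt_const s a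
  have hsin : HasDerivAt (fun u : ℝ => Real.sin u ^ 2) (2 * Real.sin (x 2) * Real.cos (x 2))
      (x 2) := by
    simpa using (Real.hasDerivAt_sin (x 2)).fun_pow 2
  fin_cases l
  · refine (pderiv_zero (fun t r θ => connTable (connCoeff V L t r θ) i j k) x).trans ?_
    refine (hasDerivAt_connTable (hasDerivAt_pi.2 fun a => ?_) i j k).deriv
    fin_cases a
    · exact hVtt
    · exact hVrt
    · exact hLtt.fun_mul ((hLt.fun_sub hVt).const_mul 2).exp
    · exact hVrt.fun_mul ((hVt.fun_sub hLt).const_mul 2).exp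
    · exact hLtt
    · exact hLrt
    · exact ((hLt.const_mul (-2)).exp.const_mul (x 1)).fun_neg
    · exact ((hLt.const_mul (-2)).exp.const_mul (x 1)).fun_neg.mul_const _
    · exact hc _ _
    · exact hc _ _
    · exact hc _ _
  · refine (pderiv_one (fun t r θ => connTable (connCoeff V L t r θ) i j k) x).trans ?_
    refine (hasDerivAt_connTable (hasDerivAt_pi.2 fun a => ?_) i j k).deriv
    fin_cases a
    · exact hVtr
    · exact hVrr
    · exact hLtr.fun_mul ((hLr.fun_sub hVr).const_mul 2).exp
    · exact hVrr.fun_mul ((hVr.fun_sub hLr).const_mul 2).exp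
    · exact hLtr
    · exact hLrr
    · exact ((hasDerivAt_id' (x 1)).fun_mul (hLr.const_mul (-2)).exp).fun_neg
    · exact ((hasDerivAt_id' (x 1)).fun_mul (hLr.const_mul (-2)).exp).fun_neg.mul_const _
    · exact hasDerivAt_inv hr
    · exact hc _ _
    · exact hc _ _
  · refine (pderiv_two (fun t r θ => connTable (connCoeff V L t r θ) i j k) x).trans ?_
    refine (hasDerivAt_connTable (hasDerivAt_pi.2 fun a => ?_) i j k).deriv
    fin_cases a
    · exact hc _ _
    · exact hc _ _
    · exact hc _ _
    · exact hc _ _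
    · exact hc _ _
    · exact hc _ _
    · exact hc _ _
    · exact hsin.const_mul _
    · exact hc _ _
    · exact ((Real.hasDerivAt_sin _).fun_mul (Real.hasDerivAt_cos _)).fun_neg
    · exact (Real.hasDerivAt_cos _).fun_div (Real.hasDerivAt_sin _) hθ
  · refine (pderiv_three (fun t r θ => connTable (connCoeff V L t r θ) i j k) x).trans ?_
    fin_cases i <;> fin_cases j <;> fin_cases k <;> rfl

/-- The Ricci tensor of `-e^{2V} dt² + e^{2L} dr² + r² (dθ² + sin² θ dφ²)`. -/
noncomputable def ricciTable (V L : ℝ → ℝ → ℝ) (t r θ : ℝ) : Fin 4 → Fin 4 → ℝ :=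
  ![![Real.exp (2 * (V t r - L t r)) * (dr (dr V) t r + dr V t r ^ 2 - dr V t r * dr L t r
          + 2 * dr V t r / r)
        - (dt (dt L) t r + dt L t r ^ 2 - dt V t r * dt L t r), 2 * dt L t r / r, 0, 0],
    ![2 * dt L t r / r, -(dr (dr V) t r + dr V t r ^ 2 - dr V t r * dr L t r
          - 2 * dr L t r / r)
        + Real.exp (2 * (L t r - V t r)) *
          (dt (dt L) t r + dt L t r ^ 2 - dt V t r * dt L t r), 0, 0],
    ![0, 0, Real.exp (-2 * L t r) * (r * (dr L t r - dr V t r) - 1) + 1, 0],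
    ![0, 0, 0, (Real.exp (-2 * L t r) * (r * (dr L t r - dr V t r) - 1) + 1) * Real.sin θ ^ 2]]

theorem ricci_expMetric (hO : IsOpen O) (hV : ContDiffOn ℝ 2 (Function.uncurry V) O)
    (hL : ContDiffOn ℝ 2 (Function.uncurry L) O) {S : Set Coord} (hS : IsOpen S)
    (hSO : ∀ x ∈ S, (x 0, x 1) ∈ O ∧ x 1 ≠ 0 ∧ Real.sin (x 2) ≠ 0) {x : Coord} (hx : x ∈ S)
    (i j : Fin 4) :
    ricci (expMetric V L) i j x = ricciTable V L (x 0) (x 1) (x 2) i j := by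
  have hΓ : ∀ i j k, ∀ y ∈ S, christoffel (expMetric V L) i j k y
      = connTable (connCoeff V L (y 0) (y 1) (y 2)) i j k := fun i j k y hy =>
    christoffel_expMetric hO (hV.of_le one_le_two) (hL.of_le one_le_two)
      (hSO y hy).1 (hSO y hy).2.1 (hSO y hy).2.2 i j k
  obtain ⟨hxO, hr, hθ⟩ := hSO x hx
  have hdΓ : ∀ l i j k, pderiv l (christoffel (expMetric V L) i j k) x
      = connTable (connDeriv V L (x 0) (x 1) (x 2) l) i j k := fun l i j k =>
    (pderiv_congr hS (hΓ i j k) l hx).trans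
      (pderiv_christoffel_expMetric hO hV hL hxO hr hθ l i j k)
  simp only [ricci, hdΓ, hΓ _ _ _ x hx]
  have e1 : Real.exp (2 * (L (x 0) (x 1) - V (x 0) (x 1)))
      = Real.exp (2 * L (x 0) (x 1)) / Real.exp (2 * V (x 0) (x 1)) := by
    rw [← Real.exp_sub]; ring_nf
  have e2 : Real.exp (2 * (V (x 0) (x 1) - L (x 0) (x 1)))
      = Real.exp (2 * V (x 0) (x 1)) / Real.exp (2 * L (x 0) (x 1)) := by
    rw [← Real.exp_sub]; ring_nf
  have e3 : Real.exp (-(2 * L (x 0) (x 1))) = (Real.exp (2 * L (x 0) (x 1)))⁻¹ := by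
    rw [← Real.exp_neg]
  have n1 := Real.exp_ne_zero (2 * L (x 0) (x 1))
  have n2 := Real.exp_ne_zero (2 * V (x 0) (x 1))
  fin_cases i <;> fin_cases j <;>
    simp [Fin.sum_univ_four, connTable, connCoeff, connDeriv, ricciTable, e1, e2, e3] <;>
    field_simp <;> ring_nf

end Curvature

/-! ### Locality of the tensors: metrics that agree on an open set -/

section Congruence

variable {g h : Coord → Matrix (Fin 4) (Fin 4) ℝ} {S : Set Coord}

theorem christoffel_congr (hS : IsOpen S) (hgh : EqOn g h S) (i j k : Fin 4) :
    EqOn (christoffel g i j k) (christoffel h i j k) S := by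
  intro x hx
  have hp : ∀ a b m, pderiv a (fun y => g y b m) x = pderiv a (fun y => h y b m) x :=
    fun a b m => pderiv_congr hS (fun y hy => by simp only [hgh hy]) a hx
  simp only [christoffel, hp, hgh hx]

theorem ricci_congr (hS : IsOpen S) (hgh : EqOn g h S) (i j : Fin 4) :
    EqOn (ricci g i j) (ricci h i j) S := by
  intro x hx
  have hp : ∀ l a b m, pderiv l (christoffel g a b m) x = pderiv l (christoffel h a b m) x :=
    fun l a b m => pderiv_congr hS (christoffel_congr hS hgh a b m) l hx
  simp only [ricci, hp, christoffel_congr hS hgh _ _ _ hx]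

theorem einstein_congr (hS : IsOpen S) (hgh : EqOn g h S) (i j : Fin 4) :
    EqOn (einstein g i j) (einstein h i j) S := by
  intro x hx
  simp only [einstein, scalarCurvature, ricci_congr hS hgh _ _ hx, hgh hx]

theorem dalembertian_congr (hS : IsOpen S) (hgh : EqOn g h S) (f : Coord → ℂ) :
    EqOn (dalembertian g f) (dalembertian h f) S := by
  intro x hx
  simp only [dalembertian, hgh hx]
  congr 1
  refine Finset.sum_congr rfl fun i _ => pderiv_congr hS (fun y hy => ?_) i hx
  simp only [hgh hy]

theorem stressEnergy_congr (hgh : EqOn g h S) (μ₀ Υ : ℝ) (f : Coord → ℂ) (i j : Fin 4) :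
    EqOn (stressEnergy μ₀ Υ g f i j) (stressEnergy μ₀ Υ h f i j) S := by
  intro x hx
  simp only [stressEnergy, normSqDifferential, hgh hx]

end Congruence

/-! ### The Einstein tensor, the d'Alembertian and the stress-energy norm -/

section Curvature

variable {O : Set (ℝ × ℝ)} {V L : ℝ → ℝ → ℝ}

/-- The Einstein tensor of `-e^{2V} dt² + e^{2L} dr² + r² (dθ² + sin² θ dφ²)`. -/
noncomputable def einsteinTable (V L : ℝ → ℝ → ℝ) (t r θ : ℝ) : Fin 4 → Fin 4 → ℝ :=
  ![![Real.exp (2 * V t r) * (Real.exp (-2 * L t r) * (2 * dr L t r / r - 1 / r ^ 2) + 1 / r ^ 2),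
      2 * dt L t r / r, 0, 0],
    ![2 * dt L t r / r, 2 * dr V t r / r + 1 / r ^ 2 - Real.exp (2 * L t r) / r ^ 2, 0, 0],
    ![0, 0, r ^ 2 * (Real.exp (-2 * L t r) * (dr (dr V) t r + dr V t r ^ 2
          - dr V t r * dr L t r + (dr V t r - dr L t r) / r)
        - Real.exp (-2 * V t r) * (dt (dt L) t r + dt L t r ^ 2 - dt L t r * dt V t r)), 0],
    ![0, 0, 0, r ^ 2 * (Real.exp (-2 * L t r) * (dr (dr V) t r + dr V t r ^ 2
          - dr V t r * dr L t r + (dr V t r - dr L t r) / r)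
        - Real.exp (-2 * V t r) * (dt (dt L) t r + dt L t r ^ 2 - dt L t r * dt V t r))
          * Real.sin θ ^ 2]]

theorem inv_expMetric (V L : ℝ → ℝ → ℝ) {x : Coord} (hr : x 1 ≠ 0) (hθ : Real.sin (x 2) ≠ 0)
    (i j : Fin 4) : (expMetric V L x)⁻¹ i j
      = if i = j then (metricDiag V L (x 0) (x 1) (x 2) i)⁻¹ else 0 :=
  inv_diagonal_apply (metricDiag_ne_zero V L hr hθ) i j

/-- Subtracting the trace cancels the second derivatives in the tt and rr entries. What is left
there determines `L_r` and `V_r`, and only the angular entries remain second order. -/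
theorem einstein_expMetric (hO : IsOpen O) (hV : ContDiffOn ℝ 2 (Function.uncurry V) O)
    (hL : ContDiffOn ℝ 2 (Function.uncurry L) O) {S : Set Coord} (hS : IsOpen S)
    (hSO : ∀ x ∈ S, (x 0, x 1) ∈ O ∧ x 1 ≠ 0 ∧ Real.sin (x 2) ≠ 0) {x : Coord} (hx : x ∈ S)
    (i j : Fin 4) :
    einstein (expMetric V L) i j x = einsteinTable V L (x 0) (x 1) (x 2) i j := by
  obtain ⟨hxO, hr, hθ⟩ := hSO x hx
  simp only [einstein, scalarCurvature, ricci_expMetric hO hV hL hS hSO hx,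
    inv_expMetric V L hr hθ, ite_mul, zero_mul, Finset.sum_ite_eq, Finset.mem_univ, if_true]
  have e1 : Real.exp (2 * (L (x 0) (x 1) - V (x 0) (x 1)))
      = Real.exp (2 * L (x 0) (x 1)) / Real.exp (2 * V (x 0) (x 1)) := by
    rw [← Real.exp_sub]; ring_nf
  have e2 : Real.exp (2 * (V (x 0) (x 1) - L (x 0) (x 1)))
      = Real.exp (2 * V (x 0) (x 1)) / Real.exp (2 * L (x 0) (x 1)) := by
    rw [← Real.exp_sub]; ring_nf
  have e3 : ∀ a : ℝ, Real.exp (-(2 * a)) = (Real.exp (2 * a))⁻¹ := fun a => Real.exp_neg _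
  have n1 := Real.exp_ne_zero (2 * L (x 0) (x 1))
  have n2 := Real.exp_ne_zero (2 * V (x 0) (x 1))
  fin_cases i <;> fin_cases j <;>
    simp [Fin.sum_univ_four, ricciTable, einsteinTable, metricDiag, expMetric, e1, e2, e3] <;>
    field_simp <;> ring

theorem pderiv_sphericalField (f : ℝ → ℝ → ℂ) (x : Coord) (i : Fin 4) :
    pderiv i (sphericalField f) x = ![dt f (x 0) (x 1), dr f (x 0) (x 1), 0, 0] i := by
  fin_cases i
  · exact pderiv_zero (fun t r _ => f t r) x
  · exact pderiv_one (fun t r _ => f t r) x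
  · exact (pderiv_two (fun t r _ => f t r) x).trans (deriv_const _ _)
  · exact pderiv_three (fun t r _ => f t r) x

/-- The densitized gradient `|g|^{1/2} gⁱʲ ∂ⱼ f` of a spherically symmetric function. -/
noncomputable def gradientDensity (V L : ℝ → ℝ → ℝ) (f : ℝ → ℝ → ℂ) (t r θ : ℝ) : Fin 4 → ℂ :=
  ![((-(Real.exp (L t r - V t r) * (r ^ 2 * Real.sin θ)) : ℝ) : ℂ) * dt f t r,
    ((Real.exp (V t r - L t r) * (r ^ 2 * Real.sin θ) : ℝ) : ℂ) * dr f t r, 0, 0]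

theorem sqrt_det_expMetric (V L : ℝ → ℝ → ℝ) {x : Coord} (hθ : 0 ≤ Real.sin (x 2)) :
    Real.sqrt |(expMetric V L x).det| = Real.exp (V (x 0) (x 1)) * Real.exp (L (x 0) (x 1))
      * (x 1 ^ 2 * Real.sin (x 2)) := by
  have h : (expMetric V L x).det = -(Real.exp (V (x 0) (x 1)) * Real.exp (L (x 0) (x 1))
      * (x 1 ^ 2 * Real.sin (x 2))) ^ 2 := by
    simp only [expMetric, Matrix.det_diagonal, Fin.prod_univ_four, metricDiag]
    simp [two_mul, Real.exp_add]
    ring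
  rw [h, abs_neg, abs_pow, sq_abs, Real.sqrt_sq (by positivity)]

theorem gradientDensity_eq (V L : ℝ → ℝ → ℝ) (f : ℝ → ℝ → ℂ) {x : Coord} (hr : x 1 ≠ 0)
    (hθ : 0 < Real.sin (x 2)) (i : Fin 4) :
    ∑ j, ((Real.sqrt |(expMetric V L x).det| * (expMetric V L x)⁻¹ i j : ℝ) : ℂ)
        * pderiv j (sphericalField f) x
      = gradientDensity V L f (x 0) (x 1) (x 2) i := by
  simp only [inv_expMetric V L hr hθ.ne', sqrt_det_expMetric V L hθ.le, pderiv_sphericalField]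
  rw [Finset.sum_eq_single i (fun j _ hj => by simp [hj.symm]) (by simp), if_pos rfl]
  have n1 := Real.exp_ne_zero (L (x 0) (x 1))
  have n2 := Real.exp_ne_zero (V (x 0) (x 1))
  fin_cases i
  · simp only [Fin.zero_eta, gradientDensity, metricDiag, Matrix.cons_val_zero]
    congr 2
    rw [Real.exp_sub, two_mul, Real.exp_add]
    field_simp
  · simp only [Fin.mk_one, gradientDensity, metricDiag, Matrix.cons_val_one, Matrix.cons_val_zero]
    congr 2
    rw [Real.exp_sub, two_mul, Real.exp_add]
    field_simp
  · simp [gradientDensity]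
  · simp [gradientDensity]

theorem dalembertian_expMetric {f : ℝ → ℝ → ℂ} (hO : IsOpen O)
    (hV : ContDiffOn ℝ 2 (Function.uncurry V) O) (hL : ContDiffOn ℝ 2 (Function.uncurry L) O)
    (hf : ContDiffOn ℝ 2 (Function.uncurry f) O) {S : Set Coord} (hS : IsOpen S)
    (hSO : ∀ x ∈ S, (x 0, x 1) ∈ O ∧ x 1 ≠ 0 ∧ 0 < Real.sin (x 2)) {x : Coord} (hx : x ∈ S) :
    dalembertian (expMetric V L) (sphericalField f) x =
      -((Real.exp (-2 * V (x 0) (x 1)) : ℝ) : ℂ) * (dt (dt f) (x 0) (x 1)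
        + ((dt L (x 0) (x 1) - dt V (x 0) (x 1) : ℝ) : ℂ) * dt f (x 0) (x 1))
      + ((Real.exp (-2 * L (x 0) (x 1)) : ℝ) : ℂ) * (dr (dr f) (x 0) (x 1)
        + ((dr V (x 0) (x 1) - dr L (x 0) (x 1) + 2 / x 1 : ℝ) : ℂ) * dr f (x 0) (x 1)) := by
  obtain ⟨hxO, hr, hθ⟩ := hSO x hx
  have hV1 := hV.of_le one_le_two
  have hL1 := hL.of_le one_le_two
  have hVt := hasDerivAt_dt hO hV1 hxO
  have hVr := hasDerivAt_dr hO hV1 hxO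
  have hLt := hasDerivAt_dt hO hL1 hxO
  have hLr := hasDerivAt_dr hO hL1 hxO
  have hftt := hasDerivAt_dt hO (contDiffOn_dt hO hf) hxO
  have hfrr := hasDerivAt_dr hO (contDiffOn_dr hO hf) hxO
  have h0 : pderiv 0 (fun y => gradientDensity V L f (y 0) (y 1) (y 2) 0) x = _ :=
    (pderiv_zero (fun t r θ => gradientDensity V L f t r θ 0) x).trans
      (((hLt.fun_sub hVt).exp.mul_const (x 1 ^ 2 * Real.sin (x 2))).fun_neg.ofReal_comp.fun_mul
        hftt).deriv
  have hr2 : HasDerivAt (fun u : ℝ => u ^ 2 * Real.sin (x 2)) (2 * x 1 * Real.sin (x 2))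
      (x 1) := by
    simpa using (hasDerivAt_pow 2 (x 1)).mul_const (Real.sin (x 2))
  have h1 : pderiv 1 (fun y => gradientDensity V L f (y 0) (y 1) (y 2) 1) x = _ :=
    (pderiv_one (fun t r θ => gradientDensity V L f t r θ 1) x).trans
      (((hVr.fun_sub hLr).exp.fun_mul hr2).ofReal_comp.fun_mul hfrr).deriv
  have h2 : pderiv 2 (fun y => gradientDensity V L f (y 0) (y 1) (y 2) 2) x = 0 :=
    (pderiv_two (fun t r θ => gradientDensity V L f t r θ 2) x).trans (deriv_const _ _)
  have h3 : pderiv 3 (fun y => gradientDensity V L f (y 0) (y 1) (y 2) 3) x = 0 :=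
    pderiv_three (fun t r θ => gradientDensity V L f t r θ 3) x
  have hp : ∀ i, pderiv i (fun y => ∑ j, ((Real.sqrt |(expMetric V L y).det|
        * (expMetric V L y)⁻¹ i j : ℝ) : ℂ) * pderiv j (sphericalField f) y) x
      = pderiv i (fun y => gradientDensity V L f (y 0) (y 1) (y 2) i) x := fun i =>
    pderiv_congr hS
      (fun y hy => gradientDensity_eq V L f (hSO y hy).2.1 (hSO y hy).2.2 i) i hx
  rw [dalembertian, Finset.sum_congr rfl fun i _ => hp i]
  simp only [Fin.sum_univ_four, h0, h1, h2, h3, sqrt_det_expMetric V L hθ.le]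
  have n1 : (Real.exp (L (x 0) (x 1)) : ℂ) ≠ 0 := by exact_mod_cast Real.exp_ne_zero _
  have n2 : (Real.exp (V (x 0) (x 1)) : ℂ) ≠ 0 := by exact_mod_cast Real.exp_ne_zero _
  have n3 : (Real.sin (x 2) : ℂ) ≠ 0 := by exact_mod_cast hθ.ne'
  have n4 : (x 1 : ℂ) ≠ 0 := by exact_mod_cast hr
  -- The volume density contains `e^V e^L`, so here the atoms are `e^V` and `e^L` rather than their
  -- squares.
  have e3 : ∀ a : ℝ, Real.exp (-2 * a) = (Real.exp a)⁻¹ ^ 2 := fun a => by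
    rw [← Real.exp_neg, ← Real.exp_nat_mul]; congr 1; push_cast; ring
  simp only [Real.exp_sub, e3]
  push_cast [-Complex.ofReal_exp, -Complex.ofReal_sin]
  field_simp
  ring

theorem normSqDifferential_expMetric (f : ℝ → ℝ → ℂ) {x : Coord} (hr : x 1 ≠ 0)
    (hθ : Real.sin (x 2) ≠ 0) :
    normSqDifferential (expMetric V L) (sphericalField f) x =
      ((Real.exp (-2 * L (x 0) (x 1)) * ‖dr f (x 0) (x 1)‖ ^ 2
        - Real.exp (-2 * V (x 0) (x 1)) * ‖dt f (x 0) (x 1)‖ ^ 2 : ℝ) : ℂ) := by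
  simp only [normSqDifferential, inv_expMetric V L hr hθ, pderiv_sphericalField]
  have e3 : ∀ a : ℝ, Real.exp (-2 * a) = (Real.exp (2 * a))⁻¹ := fun a => by
    rw [← Real.exp_neg]; ring_nf
  simp [Fin.sum_univ_four, metricDiag, Complex.mul_conj']
  simp [Complex.exp_neg]
  ring

end Curvature

/-! ### The reduced equations for `V`, `L` and the real and imaginary parts of the field -/

/-- The reduced equations on `O`: the two radial constraint equations for the metric
`-e^{2V} dt² + e^{2L} dr² + r² dω²` and the Klein-Gordon equation for `u + i v`, where `k` is
`4 π μ₀ / Υ²` and `m` is `Υ²`. -/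
structure SolvesReduced (k m : ℝ) (O : Set (ℝ × ℝ)) (u v V L : ℝ → ℝ → ℝ) : Prop where
  mass_eq : ∀ t r : ℝ, (t, r) ∈ O →
    dr L t r = Real.exp (2 * L t r) * (k * m * r * (u t r ^ 2 + v t r ^ 2) - 1 / (2 * r))
      + 1 / (2 * r) + k * r * (dr u t r ^ 2 + dr v t r ^ 2
        + (dt u t r ^ 2 + dt v t r ^ 2) * (Real.exp (2 * L t r) / Real.exp (2 * V t r)))
  potential_eq : ∀ t r : ℝ, (t, r) ∈ O →
    dr V t r = Real.exp (2 * L t r) * (1 / (2 * r) - k * m * r * (u t r ^ 2 + v t r ^ 2))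
      - 1 / (2 * r) + k * r * (dr u t r ^ 2 + dr v t r ^ 2
        + (dt u t r ^ 2 + dt v t r ^ 2) * (Real.exp (2 * L t r) / Real.exp (2 * V t r)))
  wave_re : ∀ t r : ℝ, (t, r) ∈ O →
    dt (dt u) t r = -(dt L t r - dt V t r) * dt u t r
      + Real.exp (2 * V t r) / Real.exp (2 * L t r) *
        (dr (dr u) t r + (dr V t r - dr L t r + 2 / r) * dr u t r)
      - m * Real.exp (2 * V t r) * u t r
  wave_im : ∀ t r : ℝ, (t, r) ∈ O →
    dt (dt v) t r = -(dt L t r - dt V t r) * dt v t r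
      + Real.exp (2 * V t r) / Real.exp (2 * L t r) *
        (dr (dr v) t r + (dr V t r - dr L t r + 2 / r) * dr v t r)
      - m * Real.exp (2 * V t r) * v t r

section Reduced

variable {k m : ℝ} {O : Set (ℝ × ℝ)} {u v V L : ℝ → ℝ → ℝ}

theorem hasDerivAt_exp_two_mul {F : ℝ → ℝ} {F' s : ℝ} (h : HasDerivAt F F' s) :
    HasDerivAt (fun x => Real.exp (2 * F x)) (Real.exp (2 * F s) * (2 * F')) s :=
  (h.const_mul 2).exp

theorem hasDerivAt_sq_add_sq {F G : ℝ → ℝ} {F' G' s : ℝ} (hF : HasDerivAt F F' s)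
    (hG : HasDerivAt G G' s) :
    HasDerivAt (fun x => F x ^ 2 + G x ^ 2) (2 * F s * F' + 2 * G s * G') s := by
  simpa using (hF.fun_pow 2).fun_add (hG.fun_pow 2)

/-- The momentum constraint is propagated along `r`. -/
theorem SolvesReduced.hasDerivAt_momentum_defect (h : SolvesReduced k m O u v V L)
    (hO : IsOpen O) (hr0 : ∀ t r : ℝ, (t, r) ∈ O → r ≠ 0)
    (hu : ContDiffOn ℝ 2 (Function.uncurry u) O) (hv : ContDiffOn ℝ 2 (Function.uncurry v) O)
    (hV : ContDiffOn ℝ 2 (Function.uncurry V) O) (hL : ContDiffOn ℝ 2 (Function.uncurry L) O)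
    {t r : ℝ} (hx : (t, r) ∈ O) :
    HasDerivAt (fun s => s * Real.exp (V t s - L t s) *
      (dt L t s - 2 * k * s * (dt u t s * dr u t s + dt v t s * dr v t s))) 0 r := by
  have hu1 := hu.of_le one_le_two
  have hv1 := hv.of_le one_le_two
  have hV1 := hV.of_le one_le_two
  have hL1 := hL.of_le one_le_two
  have hr := hr0 t r hx
  have hVt := hasDerivAt_dt hO hV1 hx
  have hVr := hasDerivAt_dr hO hV1 hx
  have hLt := hasDerivAt_dt hO hL1 hx
  have hLr := hasDerivAt_dr hO hL1 hx
  have hut := hasDerivAt_dt hO hu1 hx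
  have hvt := hasDerivAt_dt hO hv1 hx
  have hutt := hasDerivAt_dt hO (contDiffOn_dt hO hu) hx
  have hvtt := hasDerivAt_dt hO (contDiffOn_dt hO hv) hx
  have hurt := hasDerivAt_dt hO (contDiffOn_dr hO hu) hx
  have hvrt := hasDerivAt_dt hO (contDiffOn_dr hO hv) hx
  have hurr := hasDerivAt_dr hO (contDiffOn_dr hO hu) hx
  have hvrr := hasDerivAt_dr hO (contDiffOn_dr hO hv) hx
  have hutr := hasDerivAt_dr hO (contDiffOn_dt hO hu) hx
  have hvtr := hasDerivAt_dr hO (contDiffOn_dt hO hv) hx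
  have hLrt := hasDerivAt_dt hO (contDiffOn_dr hO hL) hx
  have hLtr := hasDerivAt_dr hO (contDiffOn_dt hO hL) hx
  have n1 := Real.exp_ne_zero (2 * L t r)
  have n2 := Real.exp_ne_zero (2 * V t r)
  -- `L_rt` is found by differentiating the mass equation in `t`, which holds on a neighbourhood,
  -- and using uniqueness of derivatives.
  have hmix := (hLrt.unique ((((hasDerivAt_exp_two_mul hLt).fun_mul
    (((hasDerivAt_sq_add_sq hut hvt).const_mul (k * m * r)).sub_const (1 / (2 * r)))).add_const
      (1 / (2 * r))).fun_add (((hasDerivAt_sq_add_sq hurt hvrt).fun_add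
        ((hasDerivAt_sq_add_sq hutt hvtt).fun_mul ((hasDerivAt_exp_two_mul hLt).fun_div
          (hasDerivAt_exp_two_mul hVt) n2))).const_mul (k * r)) |>.congr_of_eventuallyEq
      ((eventually_mem_fst hO hx).mono fun s hs => h.mass_eq s r hs)))
  have hd := ((hasDerivAt_id' r).fun_mul (hVr.fun_sub hLr).exp).fun_mul
    (hLtr.fun_sub (((hasDerivAt_id' r).const_mul (2 * k)).fun_mul
      ((hutr.fun_mul hurr).fun_add (hvtr.fun_mul hvrr))))
  -- The defect `D` satisfies the linear equation `D_r = -(1/r + V_r - L_r) D`, whose integrating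
  -- factor is `r e^{V-L}`. Once `u_tt`, `v_tt`, `L_r` and `V_r` are eliminated, this is a rational
  -- identity.
  refine hd.congr_deriv ?_
  rw [dr_dt_eq_dt_dr hO hL hx, hmix, dr_dt_eq_dt_dr hO hu hx, dr_dt_eq_dt_dr hO hv hx,
    h.wave_re t r hx, h.wave_im t r hx, h.mass_eq t r hx, h.potential_eq t r hx]
  field_simp
  ring

/-- The angular component of the Einstein equations follows from the other ones. -/
theorem SolvesReduced.angular_eq (h : SolvesReduced k m O u v V L)
    (hO : IsOpen O) (hr0 : ∀ t r : ℝ, (t, r) ∈ O → r ≠ 0)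
    (hu : ContDiffOn ℝ 2 (Function.uncurry u) O) (hv : ContDiffOn ℝ 2 (Function.uncurry v) O)
    (hV : ContDiffOn ℝ 2 (Function.uncurry V) O) (hL : ContDiffOn ℝ 2 (Function.uncurry L) O)
    (hmom : ∀ t r : ℝ, (t, r) ∈ O →
      dt L t r = 2 * k * r * (dt u t r * dr u t r + dt v t r * dr v t r))
    {t r : ℝ} (hx : (t, r) ∈ O) :
    (Real.exp (2 * L t r))⁻¹ * (dr (dr V) t r + dr V t r ^ 2 - dr V t r * dr L t r
          + (dr V t r - dr L t r) / r)
        - (Real.exp (2 * V t r))⁻¹ * (dt (dt L) t r + dt L t r ^ 2 - dt L t r * dt V t r)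
      = -2 * k * ((Real.exp (2 * L t r))⁻¹ * (dr u t r ^ 2 + dr v t r ^ 2)
        - (Real.exp (2 * V t r))⁻¹ * (dt u t r ^ 2 + dt v t r ^ 2)
        + m * (u t r ^ 2 + v t r ^ 2)) := by
  have hu1 := hu.of_le one_le_two
  have hv1 := hv.of_le one_le_two
  have hr := hr0 t r hx
  have hVr := hasDerivAt_dr hO (hV.of_le one_le_two) hx
  have hLr := hasDerivAt_dr hO (hL.of_le one_le_two) hx
  have hur := hasDerivAt_dr hO hu1 hx
  have hvr := hasDerivAt_dr hO hv1 hx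
  have hutt := hasDerivAt_dt hO (contDiffOn_dt hO hu) hx
  have hvtt := hasDerivAt_dt hO (contDiffOn_dt hO hv) hx
  have hurt := hasDerivAt_dt hO (contDiffOn_dr hO hu) hx
  have hvrt := hasDerivAt_dt hO (contDiffOn_dr hO hv) hx
  have hurr := hasDerivAt_dr hO (contDiffOn_dr hO hu) hx
  have hvrr := hasDerivAt_dr hO (contDiffOn_dr hO hv) hx
  have hutr := hasDerivAt_dr hO (contDiffOn_dt hO hu) hx
  have hvtr := hasDerivAt_dr hO (contDiffOn_dt hO hv) hx
  have hVrr := hasDerivAt_dr hO (contDiffOn_dr hO hV) hx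
  have hLtt := hasDerivAt_dt hO (contDiffOn_dt hO hL) hx
  have n1 := Real.exp_ne_zero (2 * L t r)
  have n2 := Real.exp_ne_zero (2 * V t r)
  have hinv : HasDerivAt (fun s : ℝ => 1 / (2 * s)) (-(1 / (2 * r ^ 2))) r := by
    refine ((hasDerivAt_const r (1 : ℝ)).fun_div ((hasDerivAt_id' r).const_mul 2)
      (by simpa using hr)).congr_deriv ?_
    field_simp
    ring
  -- `V_rr` comes from the `r`-derivative of the potential equation.
  have h1 := (hVrr.unique ((((hasDerivAt_exp_two_mul hLr).fun_mul
    (hinv.fun_sub (((hasDerivAt_id' r).const_mul (k * m)).fun_mul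
      (hasDerivAt_sq_add_sq hur hvr)))).fun_sub hinv).fun_add
        (((hasDerivAt_id' r).const_mul k).fun_mul ((hasDerivAt_sq_add_sq hurr hvrr).fun_add
        ((hasDerivAt_sq_add_sq hutr hvtr).fun_mul ((hasDerivAt_exp_two_mul hLr).fun_div
          (hasDerivAt_exp_two_mul hVr) n2)))) |>.congr_of_eventuallyEq
      ((eventually_mem_snd hO hx).mono fun s hs => h.potential_eq t s hs)))
  -- `L_tt` comes from the `t`-derivative of the momentum constraint. The wave equations then remove
  -- `u_tt` and `v_tt`.
  have h2 := (hLtt.unique (((hutt.fun_mul hurt).fun_add (hvtt.fun_mul hvrt)).const_mul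
    (2 * k * r) |>.congr_of_eventuallyEq
      ((eventually_mem_fst hO hx).mono fun s hs => hmom s r hs)))
  rw [h1, h2, dr_dt_eq_dt_dr hO hu hx, dr_dt_eq_dt_dr hO hv hx,
    h.wave_re t r hx, h.wave_im t r hx, hmom t r hx, h.mass_eq t r hx, h.potential_eq t r hx]
  field_simp
  ring

end Reduced

/-! ### The radial exponent -/

/-- The function `L` with `e^{2L} = (1 - 2M/r)⁻¹`. -/
noncomputable def radialExponent (M : ℝ → ℝ → ℝ) (t r : ℝ) : ℝ :=
  -(1 / 2) * Real.log (1 - 2 * M t r / r)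

section RadialExponent

variable {Ω : Set (ℝ × ℝ)} {f : ℝ → ℝ → ℂ} {V M : ℝ → ℝ → ℝ} {t r : ℝ}

theorem IsRadialRegion.isOpen_pos (hΩ : IsRadialRegion Ω) : IsOpen (Ω ∩ {q | 0 < q.2}) := by
  obtain ⟨U, hU, rfl⟩ := hΩ.relatively_open
  have h : U ∩ {q : ℝ × ℝ | 0 ≤ q.2} ∩ {q | 0 < q.2} = U ∩ {q | 0 < q.2} := by
    ext q
    simp only [mem_inter_iff, mem_ofPred_eq]
    exact ⟨fun h => ⟨h.1.1, h.2⟩, fun h => ⟨⟨h.1, h.2.le⟩, h.2⟩⟩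
  rw [h]
  exact hU.inter (isOpen_lt continuous_const continuous_snd)

theorem IsAdmissible.one_sub_pos (h : IsAdmissible Ω f V M) (hx : (t, r) ∈ Ω) (hr : 0 < r) :
    0 < 1 - 2 * M t r / r := by
  rw [sub_pos, div_lt_one hr]
  exact h.M_lt t r hx hr

theorem IsAdmissible.exp_radialExponent (h : IsAdmissible Ω f V M) (hx : (t, r) ∈ Ω)
    (hr : 0 < r) : Real.exp (2 * radialExponent M t r) = (1 - 2 * M t r / r)⁻¹ := by
  rw [radialExponent, ← mul_assoc, show (2 : ℝ) * -(1 / 2) = -1 by norm_num, neg_one_mul,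
    Real.exp_neg, Real.exp_log (h.one_sub_pos hx hr)]

theorem IsAdmissible.sqrt_eq (h : IsAdmissible Ω f V M) (hx : (t, r) ∈ Ω) (hr : 0 < r) :
    Real.sqrt (1 - 2 * M t r / r) = (Real.exp (radialExponent M t r))⁻¹ := by
  have h1 := h.exp_radialExponent hx hr
  rw [two_mul, Real.exp_add] at h1
  rw [← inv_inv (1 - 2 * M t r / r), ← h1, Real.sqrt_inv, Real.sqrt_mul_self (Real.exp_pos _).le]

theorem IsAdmissible.mass_eq_exp (h : IsAdmissible Ω f V M) (hx : (t, r) ∈ Ω) (hr : 0 < r) :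
    M t r = r / 2 * (1 - (Real.exp (2 * radialExponent M t r))⁻¹) := by
  rw [h.exp_radialExponent hx hr, inv_inv]
  field_simp
  ring

theorem IsAdmissible.contDiffOn_radialExponent (h : IsAdmissible Ω f V M) :
    ContDiffOn ℝ 2 (Function.uncurry (radialExponent M)) (Ω ∩ {q | 0 < q.2}) := by
  have h1 : ContDiffOn ℝ 2 (fun q : ℝ × ℝ => -(1 / 2) * Real.log
      (1 - 2 * Function.uncurry M q / q.2)) (Ω ∩ {q | 0 < q.2}) := by
    refine contDiffOn_const.mul (ContDiffOn.log (contDiffOn_const.sub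
      ((contDiffOn_const.mul (h.M_contDiff.mono inter_subset_left)).div
        contDiff_snd.contDiffOn fun q hq => hq.2.ne')) fun q hq => ?_)
    exact (h.one_sub_pos hq.1 hq.2).ne'
  exact h1

/-- Differentiate `M = (r/2)(1 - e^{-2L})`. The constraint is stated for `L`, whereas it is `M` that
is assumed regular up to the centre; this formula transfers the limit there to `M_t`. -/
theorem IsAdmissible.dt_mass (h : IsAdmissible Ω f V M) (hU : IsOpen (Ω ∩ {q | 0 < q.2}))
    (hx : (t, r) ∈ Ω) (hr : 0 < r) :
    dt M t r = r * (Real.exp (2 * radialExponent M t r))⁻¹ * dt (radialExponent M) t r := by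
  have hL := hasDerivAt_dt hU (h.contDiffOn_radialExponent.of_le one_le_two) ⟨hx, hr⟩
  have hd := (((hasDerivAt_exp_two_mul hL).fun_inv (Real.exp_ne_zero _)).const_sub 1).const_mul
    (r / 2)
  refine ((hd.congr_of_eventuallyEq ((eventually_mem_fst hU ⟨hx, hr⟩).mono
    fun s hs => h.mass_eq_exp hs.1 hs.2)).deriv).trans ?_
  field_simp

theorem IsAdmissible.dr_mass (h : IsAdmissible Ω f V M) (hU : IsOpen (Ω ∩ {q | 0 < q.2}))
    (hx : (t, r) ∈ Ω) (hr : 0 < r) :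
    dr M t r = (1 - (Real.exp (2 * radialExponent M t r))⁻¹) / 2
      + r * (Real.exp (2 * radialExponent M t r))⁻¹ * dr (radialExponent M) t r := by
  have hL := hasDerivAt_dr hU (h.contDiffOn_radialExponent.of_le one_le_two) ⟨hx, hr⟩
  have hd := ((hasDerivAt_id' r).div_const 2).fun_mul
    (((hasDerivAt_exp_two_mul hL).fun_inv (Real.exp_ne_zero _)).const_sub 1)
  refine ((hd.congr_of_eventuallyEq ((eventually_mem_snd hU ⟨hx, hr⟩).mono
    fun s hs => h.mass_eq_exp hs.1 hs.2)).deriv).trans ?_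
  field_simp

end RadialExponent

/-! ### Real and imaginary parts -/

theorem hasDerivAt_re {F : ℝ → ℂ} {F' : ℂ} {s : ℝ} (h : HasDerivAt F F' s) :
    HasDerivAt (fun x => (F x).re) F'.re s :=
  Complex.reCLM.hasFDerivAt.comp_hasDerivAt s h

theorem hasDerivAt_im {F : ℝ → ℂ} {F' : ℂ} {s : ℝ} (h : HasDerivAt F F' s) :
    HasDerivAt (fun x => (F x).im) F'.im s :=
  Complex.imCLM.hasFDerivAt.comp_hasDerivAt s h

/-- The real part of a function of `(t, r)`. -/
noncomputable def rePart (F : ℝ → ℝ → ℂ) (t r : ℝ) : ℝ := (F t r).re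

/-- The imaginary part of a function of `(t, r)`. -/
noncomputable def imPart (F : ℝ → ℝ → ℂ) (t r : ℝ) : ℝ := (F t r).im

section ReIm

variable {O : Set (ℝ × ℝ)} {F : ℝ → ℝ → ℂ} {t r : ℝ}

theorem contDiffOn_rePart {n : WithTop ℕ∞} (hF : ContDiffOn ℝ n (Function.uncurry F) O) :
    ContDiffOn ℝ n (Function.uncurry (rePart F)) O :=
  Complex.reCLM.contDiff.comp_contDiffOn hF

theorem contDiffOn_imPart {n : WithTop ℕ∞} (hF : ContDiffOn ℝ n (Function.uncurry F) O) :
    ContDiffOn ℝ n (Function.uncurry (imPart F)) O :=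
  Complex.imCLM.contDiff.comp_contDiffOn hF

theorem dt_rePart (hO : IsOpen O) (hF : ContDiffOn ℝ 1 (Function.uncurry F) O)
    (hx : (t, r) ∈ O) : dt (rePart F) t r = (dt F t r).re :=
  (hasDerivAt_re (hasDerivAt_dt hO hF hx)).deriv

theorem dt_imPart (hO : IsOpen O) (hF : ContDiffOn ℝ 1 (Function.uncurry F) O)
    (hx : (t, r) ∈ O) : dt (imPart F) t r = (dt F t r).im :=
  (hasDerivAt_im (hasDerivAt_dt hO hF hx)).deriv

theorem dr_rePart (hO : IsOpen O) (hF : ContDiffOn ℝ 1 (Function.uncurry F) O)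
    (hx : (t, r) ∈ O) : dr (rePart F) t r = (dr F t r).re :=
  (hasDerivAt_re (hasDerivAt_dr hO hF hx)).deriv

theorem dr_imPart (hO : IsOpen O) (hF : ContDiffOn ℝ 1 (Function.uncurry F) O)
    (hx : (t, r) ∈ O) : dr (imPart F) t r = (dr F t r).im :=
  (hasDerivAt_im (hasDerivAt_dr hO hF hx)).deriv

theorem dt_dt_rePart (hO : IsOpen O) (hF : ContDiffOn ℝ 2 (Function.uncurry F) O)
    (hx : (t, r) ∈ O) : dt (dt (rePart F)) t r = (dt (dt F) t r).re :=
  ((hasDerivAt_re (hasDerivAt_dt hO (contDiffOn_dt hO hF) hx)).congr_of_eventuallyEq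
    ((eventually_mem_fst hO hx).mono fun _ hs => dt_rePart hO (hF.of_le one_le_two) hs)).deriv

theorem dt_dt_imPart (hO : IsOpen O) (hF : ContDiffOn ℝ 2 (Function.uncurry F) O)
    (hx : (t, r) ∈ O) : dt (dt (imPart F)) t r = (dt (dt F) t r).im :=
  ((hasDerivAt_im (hasDerivAt_dt hO (contDiffOn_dt hO hF) hx)).congr_of_eventuallyEq
    ((eventually_mem_fst hO hx).mono fun _ hs => dt_imPart hO (hF.of_le one_le_two) hs)).deriv

theorem dr_dr_rePart (hO : IsOpen O) (hF : ContDiffOn ℝ 2 (Function.uncurry F) O)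
    (hx : (t, r) ∈ O) : dr (dr (rePart F)) t r = (dr (dr F) t r).re :=
  ((hasDerivAt_re (hasDerivAt_dr hO (contDiffOn_dr hO hF) hx)).congr_of_eventuallyEq
    ((eventually_mem_snd hO hx).mono fun _ hs => dr_rePart hO (hF.of_le one_le_two) hs)).deriv

theorem dr_dr_imPart (hO : IsOpen O) (hF : ContDiffOn ℝ 2 (Function.uncurry F) O)
    (hx : (t, r) ∈ O) : dr (dr (imPart F)) t r = (dr (dr F) t r).im :=
  ((hasDerivAt_im (hasDerivAt_dr hO (contDiffOn_dr hO hF) hx)).congr_of_eventuallyEq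
    ((eventually_mem_snd hO hx).mono fun _ hs => dr_imPart hO (hF.of_le one_le_two) hs)).deriv

end ReIm

theorem sq_norm_eq (z : ℂ) : ‖z‖ ^ 2 = z.re ^ 2 + z.im ^ 2 := by
  rw [Complex.sq_norm, Complex.normSq_apply]
  ring

/-- The Klein-Gordon equation for a complex field, solved for `f_tt`. -/
theorem wave_iff {m a b Lt Vt Vr Lr r : ℝ} (ha : a ≠ 0) (hb : b ≠ 0) {f ft fr ftt frr : ℂ} :
    -((b⁻¹ : ℝ) : ℂ) * (ftt + ((Lt - Vt : ℝ) : ℂ) * ft)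
        + ((a⁻¹ : ℝ) : ℂ) * (frr + ((Vr - Lr + 2 / r : ℝ) : ℂ) * fr) = (m : ℂ) * f ↔
      ftt.re = -(Lt - Vt) * ft.re + b / a * (frr.re + (Vr - Lr + 2 / r) * fr.re) - m * b * f.re ∧
      ftt.im = -(Lt - Vt) * ft.im + b / a * (frr.im + (Vr - Lr + 2 / r) * fr.im)
        - m * b * f.im := by
  have key : ∀ x y z w q : ℝ, -b⁻¹ * (x + y) + a⁻¹ * (z + w) = q ↔
      x = -y + b / a * (z + w) - b * q := by
    intro x y z w q
    field_simp
    constructor <;> intro h <;> linear_combination -h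
  rw [Complex.ext_iff]
  simp only [Complex.add_re, Complex.add_im, Complex.mul_re, Complex.mul_im, Complex.ofReal_re,
    Complex.ofReal_im, Complex.neg_re, Complex.neg_im, zero_mul, neg_zero, sub_zero, add_zero]
  rw [key, key]
  exact ⟨fun ⟨h1, h2⟩ => ⟨by linear_combination h1, by linear_combination h2⟩,
    fun ⟨h1, h2⟩ => ⟨by linear_combination h1, by linear_combination h2⟩⟩

/-! ### The first-order system and the reduced equations -/

/-- Here `a = e^{2L}`, `b = e^{2V}`, and `F`, `S`, `T`, `P` are the squared norms of `f`, `f_r`,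
`f_t`, `p`. The defects of the two equations differ by the nonzero factor `r e^{-2L}`. -/
theorem mass_iff {μ₀ Υ r a b M Lr Mr F S T P : ℝ} (hΥ : Υ ≠ 0) (hr : r ≠ 0) (ha : a ≠ 0)
    (hb : b ≠ 0) (hA : 1 - 2 * M / r = a⁻¹) (hM : Mr = (1 - a⁻¹) / 2 + r * a⁻¹ * Lr)
    (hP : P = T * (a / b)) :
    Mr = 4 * Real.pi * r ^ 2 * μ₀ * (F + (1 - 2 * M / r) * ((S + P) / Υ ^ 2)) ↔
      Lr = a * (4 * Real.pi * μ₀ / Υ ^ 2 * Υ ^ 2 * r * F - 1 / (2 * r)) + 1 / (2 * r)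
        + 4 * Real.pi * μ₀ / Υ ^ 2 * r * (S + T * (a / b)) := by
  have key : Mr - 4 * Real.pi * r ^ 2 * μ₀ * (F + (1 - 2 * M / r) * ((S + P) / Υ ^ 2))
      = r * a⁻¹ * (Lr - (a * (4 * Real.pi * μ₀ / Υ ^ 2 * Υ ^ 2 * r * F - 1 / (2 * r))
        + 1 / (2 * r) + 4 * Real.pi * μ₀ / Υ ^ 2 * r * (S + T * (a / b)))) := by
    rw [hA, hM, hP]
    field_simp
    ring
  rw [← sub_eq_zero, key, mul_eq_zero, sub_eq_zero, or_iff_right]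
  exact mul_ne_zero hr (inv_ne_zero ha)

theorem potential_iff {μ₀ Υ r a b M Vr F S T P : ℝ} (hΥ : Υ ≠ 0) (hr : r ≠ 0) (ha : a ≠ 0)
    (hb : b ≠ 0) (hA : 1 - 2 * M / r = a⁻¹) (hM : M = r / 2 * (1 - a⁻¹))
    (hP : P = T * (a / b)) :
    Vr = (1 - 2 * M / r)⁻¹ * (M / r ^ 2 - 4 * Real.pi * r * μ₀ *
        (F - (1 - 2 * M / r) * ((S + P) / Υ ^ 2))) ↔
      Vr = a * (1 / (2 * r) - 4 * Real.pi * μ₀ / Υ ^ 2 * Υ ^ 2 * r * F) - 1 / (2 * r)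
        + 4 * Real.pi * μ₀ / Υ ^ 2 * r * (S + T * (a / b)) := by
  rw [hA, hP, hM]
  refine Eq.congr_right ?_
  field_simp
  ring

section Equations

variable {μ₀ Υ : ℝ} {Ω : Set (ℝ × ℝ)} {f p : ℝ → ℝ → ℂ} {V M : ℝ → ℝ → ℝ} {t r : ℝ}

/-- The momentum in terms of the exponents of the metric. -/
theorem IsAdmissible.momentum_iff (h : IsAdmissible Ω f V M) (hx : (t, r) ∈ Ω) (hr : 0 < r) :
    p t r = dt f t r * ((Real.exp (-V t r) * (Real.sqrt (1 - 2 * M t r / r))⁻¹ : ℝ) : ℂ) ↔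
      p t r = dt f t r * ((Real.exp (radialExponent M t r - V t r) : ℝ) : ℂ) := by
  rw [h.sqrt_eq hx hr, inv_inv, sub_eq_neg_add, Real.exp_add]

/-- Division by the positive factor `e^v √A`. It serves both for the equation for `f_t` and for the
translation of initial data. -/
theorem momentum_iff_evolution {z w : ℂ} {v A : ℝ} (hA : 0 < A) :
    z = w * ((Real.exp v * Real.sqrt A : ℝ) : ℂ) ↔
      w = z * ((Real.exp (-v) * (Real.sqrt A)⁻¹ : ℝ) : ℂ) := by
  have h1 : (Real.sqrt A : ℂ) ≠ 0 := by exact_mod_cast (Real.sqrt_pos.2 hA).ne'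
  have h2 : (Real.exp v : ℂ) ≠ 0 := by exact_mod_cast Real.exp_ne_zero v
  rw [Real.exp_neg]
  push_cast [-Complex.ofReal_exp]
  constructor
  · rintro rfl
    field_simp
  · rintro rfl
    field_simp

theorem norm_sq_momentum {z w : ℂ} {l v : ℝ} (h : w = z * ((Real.exp (l - v) : ℝ) : ℂ)) :
    ‖w‖ ^ 2 = ‖z‖ ^ 2 * (Real.exp (2 * l) / Real.exp (2 * v)) := by
  rw [h, norm_mul, Complex.norm_real, Real.norm_eq_abs, Real.abs_exp, mul_pow, ← Real.exp_sub,
    ← Real.exp_nat_mul]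
  congr 2
  push_cast
  ring

/-- The evolution equation for the momentum is the Klein-Gordon equation. -/
theorem IsAdmissible.momentum_evolution_iff (h : IsAdmissible Ω f V M)
    (hU : IsOpen (Ω ∩ {q | 0 < q.2})) (hp : IsMomentumOf Ω f p V M) (hx : (t, r) ∈ Ω)
    (hr : 0 < r) :
    (deriv (fun s => p s r) t =
      ((Real.exp (V t r) : ℝ) : ℂ) *
        (-(Υ : ℂ) ^ 2 * f t r * (((Real.sqrt (1 - 2 * M t r / r))⁻¹ : ℝ) : ℂ)
          + 2 * deriv (fun s => f t s) r / (r : ℂ)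
            * ((Real.sqrt (1 - 2 * M t r / r) : ℝ) : ℂ))
      + deriv (fun s => ((Real.exp (V t s) : ℝ) : ℂ) * deriv (fun u => f t u) s
          * ((Real.sqrt (1 - 2 * M t s / s) : ℝ) : ℂ)) r) ↔
    -(((Real.exp (2 * V t r))⁻¹ : ℝ) : ℂ) * (dt (dt f) t r
        + ((dt (radialExponent M) t r - dt V t r : ℝ) : ℂ) * dt f t r)
      + (((Real.exp (2 * radialExponent M t r))⁻¹ : ℝ) : ℂ) * (dr (dr f) t r
        + ((dr V t r - dr (radialExponent M) t r + 2 / r : ℝ) : ℂ) * dr f t r)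
      = ((Υ ^ 2 : ℝ) : ℂ) * f t r := by
  set L := radialExponent M with hLdef
  have hxU : (t, r) ∈ Ω ∩ {q : ℝ × ℝ | 0 < q.2} := ⟨hx, hr⟩
  have hV1 : ContDiffOn ℝ 1 (Function.uncurry V) (Ω ∩ {q | 0 < q.2}) :=
    (h.V_contDiff.mono inter_subset_left).of_le one_le_two
  have hL1 := h.contDiffOn_radialExponent.of_le one_le_two
  have hf : ContDiffOn ℝ 2 (Function.uncurry f) (Ω ∩ {q | 0 < q.2}) :=
    h.f_contDiff.mono inter_subset_left
  have hVt := hasDerivAt_dt hU hV1 hxU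
  have hVr := hasDerivAt_dr hU hV1 hxU
  have hLt := hasDerivAt_dt hU hL1 hxU
  have hLr := hasDerivAt_dr hU hL1 hxU
  have hftt := hasDerivAt_dt hU (contDiffOn_dt hU hf) hxU
  have hfrr := hasDerivAt_dr hU (contDiffOn_dr hU hf) hxU
  -- Near `t` the momentum equals `f_t e^{L-V}`, so `p_t` is an expression in `f_tt`.
  have hpt : deriv (fun s => p s r) t = _ :=
    ((hftt.fun_mul (hLt.fun_sub hVt).exp.ofReal_comp).congr_of_eventuallyEq
      ((eventually_mem_fst hU hxU).mono fun s hs =>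
        (h.momentum_iff hs.1 hs.2).1 (hp s r hs.1 hs.2))).deriv
  have hflux : deriv (fun s => ((Real.exp (V t s) : ℝ) : ℂ) * deriv (fun u => f t u) s
      * ((Real.sqrt (1 - 2 * M t s / s) : ℝ) : ℂ)) r = _ :=
    (((hVr.exp.ofReal_comp.fun_mul hfrr).fun_mul
      (hLr.exp.fun_inv (Real.exp_ne_zero _)).ofReal_comp).congr_of_eventuallyEq
        ((eventually_mem_snd hU hxU).mono fun s hs =>
          congrArg (fun y : ℝ => ((Real.exp (V t s) : ℝ) : ℂ) * dr f t s * (y : ℂ))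
            (h.sqrt_eq hs.1 hs.2))).deriv
  rw [hpt, hflux, h.sqrt_eq hx hr, ← hLdef]
  change _ = _ * (_ + 2 * dr f t r / (r : ℂ) * _) + _ ↔ _
  have n1 : (Real.exp (L t r) : ℂ) ≠ 0 := by exact_mod_cast Real.exp_ne_zero _
  have n2 : (Real.exp (V t r) : ℂ) ≠ 0 := by exact_mod_cast Real.exp_ne_zero _
  have n4 : (r : ℂ) ≠ 0 := by exact_mod_cast hr.ne'
  rw [two_mul (V t r), two_mul (L t r), Real.exp_add, Real.exp_add, Real.exp_sub]
  push_cast [-Complex.ofReal_exp]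
  rw [← sub_eq_zero, ← sub_eq_zero (b := (Υ : ℂ) ^ 2 * f t r)]
  -- The factor `-e^{L+V}` turns the coefficient `-e^{-2V}` of `f_tt` in the wave equation into its
  -- coefficient `e^{L-V}` in `p_t`.
  refine Iff.trans (b := -((Real.exp (L t r) : ℂ) * Real.exp (V t r)) * _ = 0) (Eq.congr_left ?_)
    ((mul_eq_zero).trans (or_iff_right (neg_ne_zero.2 (mul_ne_zero n1 n2))))
  field_simp
  ring

theorem IsAdmissible.wave_iff_reduced (h : IsAdmissible Ω f V M)
    (hU : IsOpen (Ω ∩ {q | 0 < q.2})) (hx : (t, r) ∈ Ω) (hr : 0 < r) :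
    -(((Real.exp (2 * V t r))⁻¹ : ℝ) : ℂ) * (dt (dt f) t r
        + ((dt (radialExponent M) t r - dt V t r : ℝ) : ℂ) * dt f t r)
      + (((Real.exp (2 * radialExponent M t r))⁻¹ : ℝ) : ℂ) * (dr (dr f) t r
        + ((dr V t r - dr (radialExponent M) t r + 2 / r : ℝ) : ℂ) * dr f t r)
      = ((Υ ^ 2 : ℝ) : ℂ) * f t r ↔
    (dt (dt (rePart f)) t r =
        -(dt (radialExponent M) t r - dt V t r) * dt (rePart f) t r
        + Real.exp (2 * V t r) / Real.exp (2 * radialExponent M t r) * (dr (dr (rePart f)) t r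
          + (dr V t r - dr (radialExponent M) t r + 2 / r) * dr (rePart f) t r)
        - Υ ^ 2 * Real.exp (2 * V t r) * rePart f t r) ∧
      dt (dt (imPart f)) t r =
        -(dt (radialExponent M) t r - dt V t r) * dt (imPart f) t r
        + Real.exp (2 * V t r) / Real.exp (2 * radialExponent M t r) * (dr (dr (imPart f)) t r
          + (dr V t r - dr (radialExponent M) t r + 2 / r) * dr (imPart f) t r)
        - Υ ^ 2 * Real.exp (2 * V t r) * imPart f t r := by
  have hxU : (t, r) ∈ Ω ∩ {q : ℝ × ℝ | 0 < q.2} := ⟨hx, hr⟩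
  have hf : ContDiffOn ℝ 2 (Function.uncurry f) (Ω ∩ {q | 0 < q.2}) :=
    h.f_contDiff.mono inter_subset_left
  have hf1 := hf.of_le one_le_two
  rw [wave_iff (Real.exp_ne_zero _) (Real.exp_ne_zero _), dt_dt_rePart hU hf hxU,
    dt_dt_imPart hU hf hxU, dr_dr_rePart hU hf hxU, dr_dr_imPart hU hf hxU, dt_rePart hU hf1 hxU,
    dt_imPart hU hf1 hxU, dr_rePart hU hf1 hxU, dr_imPart hU hf1 hxU]
  rfl

theorem IsAdmissible.sq_norms (h : IsAdmissible Ω f V M) (hU : IsOpen (Ω ∩ {q | 0 < q.2}))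
    (hx : (t, r) ∈ Ω) (hr : 0 < r) :
    ‖f t r‖ ^ 2 = rePart f t r ^ 2 + imPart f t r ^ 2 ∧
      ‖dt f t r‖ ^ 2 = dt (rePart f) t r ^ 2 + dt (imPart f) t r ^ 2 ∧
      ‖dr f t r‖ ^ 2 = dr (rePart f) t r ^ 2 + dr (imPart f) t r ^ 2 := by
  have hxU : (t, r) ∈ Ω ∩ {q : ℝ × ℝ | 0 < q.2} := ⟨hx, hr⟩
  have hf1 : ContDiffOn ℝ 1 (Function.uncurry f) (Ω ∩ {q | 0 < q.2}) :=
    (h.f_contDiff.mono inter_subset_left).of_le one_le_two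
  rw [dt_rePart hU hf1 hxU, dt_imPart hU hf1 hxU, dr_rePart hU hf1 hxU, dr_imPart hU hf1 hxU]
  exact ⟨sq_norm_eq _, sq_norm_eq _, sq_norm_eq _⟩

/-- The reduced equations for the scalar field `f` and the metric given by `V` and `M`. -/
def SolvesReducedEKG (μ₀ Υ : ℝ) (Ω : Set (ℝ × ℝ)) (f : ℝ → ℝ → ℂ) (V M : ℝ → ℝ → ℝ) : Prop :=
  SolvesReduced (4 * Real.pi * μ₀ / Υ ^ 2) (Υ ^ 2) (Ω ∩ {q | 0 < q.2}) (rePart f) (imPart f) V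
    (radialExponent M)

/-- Since `p = f_t e^{L-V}` with `f` of class `C²`, the regularity clause for `p` in the first-order
system is automatic. -/
theorem IsAdmissible.contDiffOn_momentum (h : IsAdmissible Ω f V M)
    (hU : IsOpen (Ω ∩ {q | 0 < q.2})) (hp : IsMomentumOf Ω f p V M) :
    ContDiffOn ℝ 1 (Function.uncurry p) (Ω ∩ {q | 0 < q.2}) := by
  have h1 : ContDiffOn ℝ 1 (fun q : ℝ × ℝ => Function.uncurry (dt f) q *
      Complex.ofRealCLM (Real.exp (Function.uncurry (radialExponent M) q - Function.uncurry V q)))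
      (Ω ∩ {q | 0 < q.2}) := by
    refine (contDiffOn_dt hU (h.f_contDiff.mono inter_subset_left)).mul
      (Complex.ofRealCLM.contDiff.comp_contDiffOn (ContDiffOn.exp ?_))
    exact (h.contDiffOn_radialExponent.of_le one_le_two).sub
      ((h.V_contDiff.mono inter_subset_left).of_le one_le_two)
  exact h1.congr fun q hq => (h.momentum_iff hq.1 hq.2).1 (hp q.1 q.2 hq.1 hq.2)

/-- The equation for `f_t` is the formula for `p`. Given that formula, `|p|² = |f_t|² e^{2L-2V}`,
and the remaining equations match the reduced ones pointwise. -/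
theorem IsAdmissible.solvesSystem_iff (h : IsAdmissible Ω f V M) (hΥ : Υ ≠ 0)
    (hU : IsOpen (Ω ∩ {q | 0 < q.2})) :
    SolvesSystem μ₀ Υ Ω f p V M ↔ SolvesReducedEKG μ₀ Υ Ω f V M ∧ IsMomentumOf Ω f p V M := by
  have hmom : (∀ t r : ℝ, (t, r) ∈ Ω → 0 < r → deriv (fun s => f s r) t =
      p t r * ((Real.exp (V t r) * Real.sqrt (1 - 2 * M t r / r) : ℝ) : ℂ)) ↔
        IsMomentumOf Ω f p V M :=
    forall₄_congr fun t r hx hr => momentum_iff_evolution (h.one_sub_pos hx hr)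
  have hmass : IsMomentumOf Ω f p V M → ∀ {t r : ℝ}, (t, r) ∈ Ω → 0 < r →
      (deriv (fun s => M t s) r =
        massRHS μ₀ Υ r (f t r) (deriv (fun s => f t s) r) (p t r) (M t r) ↔
        dr (radialExponent M) t r = Real.exp (2 * radialExponent M t r) *
          (4 * Real.pi * μ₀ / Υ ^ 2 * Υ ^ 2 * r * (rePart f t r ^ 2 + imPart f t r ^ 2)
            - 1 / (2 * r)) + 1 / (2 * r) +
              4 * Real.pi * μ₀ / Υ ^ 2 * r * (dr (rePart f) t r ^ 2 + dr (imPart f) t r ^ 2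
          + (dt (rePart f) t r ^ 2 + dt (imPart f) t r ^ 2) *
            (Real.exp (2 * radialExponent M t r) / Real.exp (2 * V t r)))) := by
    intro hp t r hx hr
    have hn := h.sq_norms hU hx hr
    refine (mass_iff (Lr := dr (radialExponent M) t r) hΥ hr.ne' (Real.exp_ne_zero _)
      (Real.exp_ne_zero _) ?_ (h.dr_mass hU hx hr)
      (norm_sq_momentum ((h.momentum_iff hx hr).1 (hp t r hx hr)))).trans ?_
    · rw [h.exp_radialExponent hx hr, inv_inv]
    · rw [hn.1, hn.2.1, ← hn.2.2]
      rfl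
  have hpot : IsMomentumOf Ω f p V M → ∀ {t r : ℝ}, (t, r) ∈ Ω → 0 < r →
      (deriv (fun s => V t s) r =
        potentialRHS μ₀ Υ r (f t r) (deriv (fun s => f t s) r) (p t r) (M t r) ↔
        dr V t r = Real.exp (2 * radialExponent M t r) * (1 / (2 * r)
          - 4 * Real.pi * μ₀ / Υ ^ 2 * Υ ^ 2 * r * (rePart f t r ^ 2 + imPart f t r ^ 2))
            - 1 / (2 * r) +
              4 * Real.pi * μ₀ / Υ ^ 2 * r * (dr (rePart f) t r ^ 2 + dr (imPart f) t r ^ 2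
          + (dt (rePart f) t r ^ 2 + dt (imPart f) t r ^ 2) *
            (Real.exp (2 * radialExponent M t r) / Real.exp (2 * V t r)))) := by
    intro hp t r hx hr
    have hn := h.sq_norms hU hx hr
    refine (potential_iff (Vr := dr V t r) hΥ hr.ne' (Real.exp_ne_zero _)
      (Real.exp_ne_zero _) ?_ (h.mass_eq_exp hx hr)
      (norm_sq_momentum ((h.momentum_iff hx hr).1 (hp t r hx hr)))).trans ?_
    · rw [h.exp_radialExponent hx hr, inv_inv]
    · rw [hn.1, hn.2.1, ← hn.2.2]
      rfl
  constructor
  · intro hs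
    have hp := hmom.1 hs.f_evolution
    have hw := fun t r hx hr => (h.wave_iff_reduced hU hx hr).1
      ((h.momentum_evolution_iff hU hp hx hr).1 (hs.p_evolution t r hx hr))
    exact ⟨⟨fun t r hx => (hmass hp hx.1 hx.2).1 (hs.mass_eq t r hx.1 hx.2),
      fun t r hx => (hpot hp hx.1 hx.2).1 (hs.potential_eq t r hx.1 hx.2),
      fun t r hx => (hw t r hx.1 hx.2).1, fun t r hx => (hw t r hx.1 hx.2).2⟩, hp⟩
  · rintro ⟨hs, hp⟩
    exact ⟨h.contDiffOn_momentum hU hp,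
      fun t r hx hr => (hmass hp hx hr).2 (hs.mass_eq t r ⟨hx, hr⟩),
      fun t r hx hr => (hpot hp hx hr).2 (hs.potential_eq t r ⟨hx, hr⟩), hmom.2 hp,
      fun t r hx hr => (h.momentum_evolution_iff hU hp hx hr).2
        ((h.wave_iff_reduced hU hx hr).2 ⟨hs.wave_re t r ⟨hx, hr⟩, hs.wave_im t r ⟨hx, hr⟩⟩)⟩

end Equations

/-! ### The Einstein-Klein-Gordon equations and the reduced equations -/

theorem exp_neg_two_mul (a : ℝ) : Real.exp (-2 * a) = (Real.exp (2 * a))⁻¹ := by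
  rw [← Real.exp_neg, neg_mul]

/-- The momentum constraint, which is the `tr` component of the Einstein equations. -/
def MomentumConstraint (μ₀ Υ : ℝ) (Ω : Set (ℝ × ℝ)) (f : ℝ → ℝ → ℂ) (M : ℝ → ℝ → ℝ) : Prop :=
  ∀ t r : ℝ, (t, r) ∈ Ω ∩ {q : ℝ × ℝ | 0 < q.2} →
    dt (radialExponent M) t r = 2 * (4 * Real.pi * μ₀ / Υ ^ 2) * r *
      (dt (rePart f) t r * dr (rePart f) t r + dt (imPart f) t r * dr (imPart f) t r)

/-- The tensor is real because `z w̄ + z̄ w = 2 Re(z w̄)`, so the Einstein equations may be compared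
over `ℝ`. -/
theorem stressEnergy_expMetric (μ₀ Υ : ℝ) (V L : ℝ → ℝ → ℝ) (f : ℝ → ℝ → ℂ) {x : Coord}
    (hr : x 1 ≠ 0) (hθ : Real.sin (x 2) ≠ 0) (i j : Fin 4) :
    stressEnergy μ₀ Υ (expMetric V L) (sphericalField f) i j x =
      ((μ₀ * (2 * ((![dt f (x 0) (x 1), dr f (x 0) (x 1), 0, 0] : Fin 4 → ℂ) i
          * starRingEnd ℂ ((![dt f (x 0) (x 1), dr f (x 0) (x 1), 0, 0] : Fin 4 → ℂ) j)).re / Υ ^ 2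
        - (((Real.exp (2 * L (x 0) (x 1)))⁻¹ * ‖dr f (x 0) (x 1)‖ ^ 2
          - (Real.exp (2 * V (x 0) (x 1)))⁻¹ * ‖dt f (x 0) (x 1)‖ ^ 2) / Υ ^ 2
          + ‖f (x 0) (x 1)‖ ^ 2) * expMetric V L x i j) : ℝ) : ℂ) := by
  have hre : ∀ z w : ℂ, z * starRingEnd ℂ w + starRingEnd ℂ z * w
      = ((2 * (z * starRingEnd ℂ w).re : ℝ) : ℂ) := by
    intro z w
    rw [← Complex.add_conj, map_mul, Complex.conj_conj]
  rw [stressEnergy, normSqDifferential_expMetric f hr hθ, pderiv_sphericalField,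
    pderiv_sphericalField, hre, exp_neg_two_mul, exp_neg_two_mul, sphericalField]
  push_cast
  rfl

/-- In this lemma and the next two, the defect of the Einstein component is a nonzero multiple of
the defect of the solved form: `2b/(ar)` for tt, `2/r` for rr and tr. -/
theorem einstein_tt_iff {μ₀ Υ r a b Lr F S T : ℝ} (hΥ : Υ ≠ 0) (hr : r ≠ 0) (ha : a ≠ 0)
    (hb : b ≠ 0) :
    b * (a⁻¹ * (2 * Lr / r - 1 / r ^ 2) + 1 / r ^ 2) = 8 * Real.pi * (μ₀ * (2 * T / Υ ^ 2
        - ((a⁻¹ * S - b⁻¹ * T) / Υ ^ 2 + F) * -b)) ↔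
      Lr = a * (4 * Real.pi * μ₀ / Υ ^ 2 * Υ ^ 2 * r * F - 1 / (2 * r)) + 1 / (2 * r)
        + 4 * Real.pi * μ₀ / Υ ^ 2 * r * (S + T * (a / b)) := by
  have key : b * (a⁻¹ * (2 * Lr / r - 1 / r ^ 2) + 1 / r ^ 2) - 8 * Real.pi * (μ₀ *
      (2 * T / Υ ^ 2 - ((a⁻¹ * S - b⁻¹ * T) / Υ ^ 2 + F) * -b))
      = 2 * b / (a * r) * (Lr - (a * (4 * Real.pi * μ₀ / Υ ^ 2 * Υ ^ 2 * r * F - 1 / (2 * r))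
        + 1 / (2 * r) + 4 * Real.pi * μ₀ / Υ ^ 2 * r * (S + T * (a / b)))) := by
    field_simp
    ring
  rw [← sub_eq_zero, key, mul_eq_zero, sub_eq_zero, or_iff_right]
  exact div_ne_zero (mul_ne_zero two_ne_zero hb) (mul_ne_zero ha hr)

theorem einstein_rr_iff {μ₀ Υ r a b Vr F S T : ℝ} (hΥ : Υ ≠ 0) (hr : r ≠ 0) (ha : a ≠ 0)
    (hb : b ≠ 0) :
    2 * Vr / r + 1 / r ^ 2 - a / r ^ 2 = 8 * Real.pi * (μ₀ * (2 * S / Υ ^ 2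
        - ((a⁻¹ * S - b⁻¹ * T) / Υ ^ 2 + F) * a)) ↔
      Vr = a * (1 / (2 * r) - 4 * Real.pi * μ₀ / Υ ^ 2 * Υ ^ 2 * r * F) - 1 / (2 * r)
        + 4 * Real.pi * μ₀ / Υ ^ 2 * r * (S + T * (a / b)) := by
  have key : 2 * Vr / r + 1 / r ^ 2 - a / r ^ 2 - 8 * Real.pi * (μ₀ * (2 * S / Υ ^ 2
        - ((a⁻¹ * S - b⁻¹ * T) / Υ ^ 2 + F) * a))
      = 2 / r * (Vr - (a * (1 / (2 * r) - 4 * Real.pi * μ₀ / Υ ^ 2 * Υ ^ 2 * r * F) - 1 / (2 * r)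
        + 4 * Real.pi * μ₀ / Υ ^ 2 * r * (S + T * (a / b)))) := by
    field_simp
    ring
  rw [← sub_eq_zero, key, mul_eq_zero, sub_eq_zero, or_iff_right]
  exact div_ne_zero two_ne_zero hr

theorem einstein_tr_iff {μ₀ Υ r Lt X : ℝ} (hr : r ≠ 0) :
    2 * Lt / r = 8 * Real.pi * (μ₀ * (2 * X / Υ ^ 2)) ↔
      Lt = 2 * (4 * Real.pi * μ₀ / Υ ^ 2) * r * X := by
  have key : 2 * Lt / r - 8 * Real.pi * (μ₀ * (2 * X / Υ ^ 2))
      = 2 / r * (Lt - 2 * (4 * Real.pi * μ₀ / Υ ^ 2) * r * X) := by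
    field_simp
    ring
  rw [← sub_eq_zero, key, mul_eq_zero, sub_eq_zero, or_iff_right]
  exact div_ne_zero two_ne_zero hr

theorem mul_conj_re (z w : ℂ) : (z * starRingEnd ℂ w).re = z.re * w.re + z.im * w.im := by
  simp

theorem mul_conj_self_re (z : ℂ) : (z * starRingEnd ℂ z).re = ‖z‖ ^ 2 := by
  rw [mul_conj_re, sq_norm_eq]
  ring

section Equations

variable {μ₀ Υ : ℝ} {Ω : Set (ℝ × ℝ)} {f : ℝ → ℝ → ℂ} {V M : ℝ → ℝ → ℝ}

theorem IsAdmissible.eqOn_polarChart (h : IsAdmissible Ω f V M) :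
    EqOn (polarArealMetric V M) (expMetric V (radialExponent M)) (polarChart Ω) := by
  intro x hx
  simp only [polarArealMetric, expMetric, metricDiag, h.exp_radialExponent hx.1 hx.2.1]

/-- The Einstein-Klein-Gordon equations in terms of `V` and `L`. -/
theorem IsAdmissible.solvesEKG_iff_tables (h : IsAdmissible Ω f V M)
    (hU : IsOpen (Ω ∩ {q | 0 < q.2})) :
    SolvesEKG μ₀ Υ Ω f V M ↔ ∀ x ∈ polarChart Ω,
      (∀ i j, einsteinTable V (radialExponent M) (x 0) (x 1) (x 2) i j = 8 * Real.pi *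
        (μ₀ * (2 * ((![dt f (x 0) (x 1), dr f (x 0) (x 1), 0, 0] : Fin 4 → ℂ) i
          * starRingEnd ℂ ((![dt f (x 0) (x 1), dr f (x 0) (x 1), 0, 0] : Fin 4 → ℂ) j)).re / Υ ^ 2
        - (((Real.exp (2 * radialExponent M (x 0) (x 1)))⁻¹ * ‖dr f (x 0) (x 1)‖ ^ 2
          - (Real.exp (2 * V (x 0) (x 1)))⁻¹ * ‖dt f (x 0) (x 1)‖ ^ 2) / Υ ^ 2
          + ‖f (x 0) (x 1)‖ ^ 2) * expMetric V (radialExponent M) x i j))) ∧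
      -(((Real.exp (2 * V (x 0) (x 1)))⁻¹ : ℝ) : ℂ) * (dt (dt f) (x 0) (x 1)
        + ((dt (radialExponent M) (x 0) (x 1) - dt V (x 0) (x 1) : ℝ) : ℂ) * dt f (x 0) (x 1))
      + (((Real.exp (2 * radialExponent M (x 0) (x 1)))⁻¹ : ℝ) : ℂ) * (dr (dr f) (x 0) (x 1)
        + ((dr V (x 0) (x 1) - dr (radialExponent M) (x 0) (x 1) + 2 / x 1 : ℝ) : ℂ)
          * dr f (x 0) (x 1)) = ((Υ ^ 2 : ℝ) : ℂ) * f (x 0) (x 1) := by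
  have hS := polarChart_isOpen hU
  have hsin : ∀ x ∈ polarChart Ω, 0 < Real.sin (x 2) := fun x hx =>
    Real.sin_pos_of_pos_of_lt_pi hx.2.2.1 hx.2.2.2
  have hV : ContDiffOn ℝ 2 (Function.uncurry V) (Ω ∩ {q | 0 < q.2}) :=
    h.V_contDiff.mono inter_subset_left
  have hf : ContDiffOn ℝ 2 (Function.uncurry f) (Ω ∩ {q | 0 < q.2}) :=
    h.f_contDiff.mono inter_subset_left
  have hL := h.contDiffOn_radialExponent
  have hein : ∀ x ∈ polarChart Ω, ∀ i j, einstein (polarArealMetric V M) i j x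
      = einsteinTable V (radialExponent M) (x 0) (x 1) (x 2) i j := fun x hx i j =>
    (einstein_congr hS h.eqOn_polarChart i j hx).trans (einstein_expMetric hU hV hL hS
      (fun y hy => ⟨⟨hy.1, hy.2.1⟩, hy.2.1.ne', (hsin y hy).ne'⟩) hx i j)
  have hstress : ∀ x ∈ polarChart Ω, ∀ i j,
      stressEnergy μ₀ Υ (polarArealMetric V M) (sphericalField f) i j x = _ := fun x hx i j =>
    (stressEnergy_congr h.eqOn_polarChart μ₀ Υ _ i j hx).trans
      (stressEnergy_expMetric μ₀ Υ V _ f hx.2.1.ne' (hsin x hx).ne' i j)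
  have hbox : ∀ x ∈ polarChart Ω,
      dalembertian (polarArealMetric V M) (sphericalField f) x = _ := fun x hx =>
    (dalembertian_congr hS h.eqOn_polarChart _ hx).trans (dalembertian_expMetric hU hV hL hf hS
      (fun y hy => ⟨⟨hy.1, hy.2.1⟩, hy.2.1.ne', hsin y hy⟩) hx)
  have hcast : ∀ y z : ℝ, ((y : ℝ) : ℂ) = 8 * (Real.pi : ℂ) * (z : ℂ) ↔ y = 8 * Real.pi * z := by
    intro y z
    norm_cast
  have hsq : ((Υ ^ 2 : ℝ) : ℂ) = (Υ : ℂ) ^ 2 := by push_cast; rfl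
  constructor
  · intro hs x hx
    refine ⟨fun i j => ?_, ?_⟩
    · rw [← hcast, ← hein x hx, ← hstress x hx]
      exact hs.einstein_eq x hx i j
    · rw [← exp_neg_two_mul, ← exp_neg_two_mul, ← hbox x hx, hsq]
      exact hs.kleinGordon_eq x hx
  · intro hs
    refine ⟨fun x hx i j => ?_, fun x hx => ?_⟩
    · rw [hein x hx, hstress x hx, hcast]
      exact (hs x hx).1 i j
    · rw [hbox x hx, exp_neg_two_mul, exp_neg_two_mul, ← hsq]
      exact (hs x hx).2

/-- The tt, rr and tr components are the two radial equations and the momentum constraint. The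
angular ones are consequences, by `SolvesReduced.angular_eq`. -/
theorem IsAdmissible.solvesEKG_iff (h : IsAdmissible Ω f V M) (hΥ : Υ ≠ 0)
    (hU : IsOpen (Ω ∩ {q | 0 < q.2})) :
    SolvesEKG μ₀ Υ Ω f V M ↔
      SolvesReducedEKG μ₀ Υ Ω f V M ∧ MomentumConstraint μ₀ Υ Ω f M := by
  have hV : ContDiffOn ℝ 2 (Function.uncurry V) (Ω ∩ {q | 0 < q.2}) :=
    h.V_contDiff.mono inter_subset_left
  have hf : ContDiffOn ℝ 2 (Function.uncurry f) (Ω ∩ {q | 0 < q.2}) :=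
    h.f_contDiff.mono inter_subset_left
  have hf1 := hf.of_le one_le_two
  have hX : ∀ {t r : ℝ}, (t, r) ∈ Ω ∩ {q : ℝ × ℝ | 0 < q.2} →
      (dt f t r * starRingEnd ℂ (dr f t r)).re
        = dt (rePart f) t r * dr (rePart f) t r + dt (imPart f) t r * dr (imPart f) t r := by
    intro t r hx
    rw [mul_conj_re, dt_rePart hU hf1 hx, dt_imPart hU hf1 hx, dr_rePart hU hf1 hx,
      dr_imPart hU hf1 hx]
  have hX' : ∀ {t r : ℝ}, (t, r) ∈ Ω ∩ {q : ℝ × ℝ | 0 < q.2} →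
      (dr f t r * starRingEnd ℂ (dt f t r)).re
        = dt (rePart f) t r * dr (rePart f) t r + dt (imPart f) t r * dr (imPart f) t r := by
    intro t r hx
    rw [← hX hx, mul_conj_re, mul_conj_re]
    ring
  rw [h.solvesEKG_iff_tables hU]
  constructor
  · intro hs
    -- The equations to be extracted do not involve the angles, so one chart point above `(t, r)`
    -- suffices; it is taken on the equator.
    have hpt : ∀ {t r : ℝ}, (t, r) ∈ Ω ∩ {q : ℝ × ℝ | 0 < q.2} →
        (![t, r, Real.pi / 2, 0] : Coord) ∈ polarChart Ω := fun hx =>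
      ⟨hx.1, hx.2, Real.pi_div_two_pos, half_lt_self Real.pi_pos⟩
    refine ⟨⟨fun t r hx => ?_, fun t r hx => ?_,
      fun t r hx => ((h.wave_iff_reduced hU hx.1 hx.2).1 (hs _ (hpt hx)).2).1,
      fun t r hx => ((h.wave_iff_reduced hU hx.1 hx.2).1 (hs _ (hpt hx)).2).2⟩,
      fun t r hx => ?_⟩
    · obtain ⟨hn1, hn2, hn3⟩ := h.sq_norms hU hx.1 hx.2
      have he := (hs _ (hpt hx)).1 0 0
      simp only [einsteinTable, expMetric, metricDiag, Matrix.diagonal_apply_eq,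
        Matrix.cons_val_zero, Matrix.cons_val_one, mul_conj_self_re, exp_neg_two_mul] at he
      rw [einstein_tt_iff hΥ hx.2.ne' (Real.exp_ne_zero _) (Real.exp_ne_zero _)] at he
      rw [← hn1, ← hn2, ← hn3]
      exact he
    · obtain ⟨hn1, hn2, hn3⟩ := h.sq_norms hU hx.1 hx.2
      have he := (hs _ (hpt hx)).1 1 1
      simp only [einsteinTable, expMetric, metricDiag, Matrix.diagonal_apply_eq,
        Matrix.cons_val_zero, Matrix.cons_val_one, mul_conj_self_re] at he
      rw [einstein_rr_iff hΥ hx.2.ne' (Real.exp_ne_zero _) (Real.exp_ne_zero _)] at he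
      rw [← hn1, ← hn2, ← hn3]
      exact he
    · have he := (hs _ (hpt hx)).1 0 1
      simp only [einsteinTable, expMetric, ne_eq, zero_ne_one, not_false_eq_true,
        Matrix.diagonal_apply_ne, mul_zero, sub_zero,
        Matrix.cons_val_zero, Matrix.cons_val_one, hX hx] at he
      exact (einstein_tr_iff hx.2.ne').1 he
  · rintro ⟨hs, hm⟩ x hx
    have hxU : (x 0, x 1) ∈ Ω ∩ {q : ℝ × ℝ | 0 < q.2} := ⟨hx.1, hx.2.1⟩
    have hr : x 1 ≠ 0 := hx.2.1.ne'
    refine ⟨fun i j => ?_, (h.wave_iff_reduced hU hx.1 hx.2.1).2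
      ⟨hs.wave_re _ _ hxU, hs.wave_im _ _ hxU⟩⟩
    obtain ⟨hn1, hn2, hn3⟩ := h.sq_norms hU hx.1 hx.2.1
    have htt := hs.mass_eq _ _ hxU
    have hrr := hs.potential_eq _ _ hxU
    have htr := hm _ _ hxU
    have hθθ := SolvesReduced.angular_eq hs hU (fun t r hx => hx.2.ne') (contDiffOn_rePart hf)
      (contDiffOn_imPart hf) hV h.contDiffOn_radialExponent hm hxU
    rw [← hn1, ← hn2, ← hn3] at htt hrr hθθ
    rw [← einstein_tt_iff hΥ hr (Real.exp_ne_zero _) (Real.exp_ne_zero _)] at htt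
    rw [← einstein_rr_iff hΥ hr (Real.exp_ne_zero _) (Real.exp_ne_zero _)] at hrr
    rw [← einstein_tr_iff hr] at htr
    -- Both angular components at once: `s = 1` gives θθ and `s = sin² θ` gives φφ. The zero stands
    -- for the vanishing angular derivatives of `f`.
    have hang : ∀ s : ℝ, x 1 ^ 2 * ((Real.exp (2 * radialExponent M (x 0) (x 1)))⁻¹ *
        (dr (dr V) (x 0) (x 1) + dr V (x 0) (x 1) ^ 2
          - dr V (x 0) (x 1) * dr (radialExponent M) (x 0) (x 1)
          + (dr V (x 0) (x 1) - dr (radialExponent M) (x 0) (x 1)) / x 1)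
        - (Real.exp (2 * V (x 0) (x 1)))⁻¹ * (dt (dt (radialExponent M)) (x 0) (x 1)
          + dt (radialExponent M) (x 0) (x 1) ^ 2
          - dt (radialExponent M) (x 0) (x 1) * dt V (x 0) (x 1))) * s
        = 8 * Real.pi * (μ₀ * (2 * (0 : ℝ) / Υ ^ 2
          - (((Real.exp (2 * radialExponent M (x 0) (x 1)))⁻¹ * ‖dr f (x 0) (x 1)‖ ^ 2
          - (Real.exp (2 * V (x 0) (x 1)))⁻¹ * ‖dt f (x 0) (x 1)‖ ^ 2) / Υ ^ 2
          + ‖f (x 0) (x 1)‖ ^ 2) * (x 1 ^ 2 * s))) := by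
      intro s
      rw [hθθ]
      field_simp
      ring
    fin_cases i <;> fin_cases j <;>
      simp [einsteinTable, expMetric, metricDiag, -Complex.mul_re, mul_conj_self_re, hX hxU,
        hX' hxU, ← neg_mul, exp_neg_two_mul]
    · linear_combination htt
    · linear_combination htr
    · linear_combination htr
    · linear_combination hrr
    · linear_combination hang 1
    · linear_combination hang (Real.sin (x 2) ^ 2)

end Equations

/-! ### Behaviour at the centre -/

section Centre

variable {Ω : Set (ℝ × ℝ)}

/-- Ω is a relatively open piece of a convex half-plane with nonempty interior. Derivatives within Ω
are therefore well defined, and continuous for smooth functions, also at boundary points `r = 0`. -/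
theorem IsRadialRegion.uniqueDiffOn (hΩ : IsRadialRegion Ω) : UniqueDiffOn ℝ Ω := by
  obtain ⟨U, hU, rfl⟩ := hΩ.relatively_open
  rw [inter_comm]
  refine UniqueDiffOn.inter (uniqueDiffOn_convex ?_ ?_) hU
  · exact convex_halfSpace_ge (f := Prod.snd) ⟨fun _ _ => rfl, fun _ _ => rfl⟩ 0
  · refine ⟨((0 : ℝ), (1 : ℝ)), mem_interior.2 ⟨{q | 0 < q.2}, ?_, ?_, ?_⟩⟩
    · exact fun q hq => le_of_lt (show (0 : ℝ) < q.2 from hq)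
    · exact isOpen_lt continuous_const continuous_snd
    · exact zero_lt_one (α := ℝ)

theorem IsRadialRegion.eventually_mem_slice (hΩ : IsRadialRegion Ω) {t r : ℝ}
    (hx : (t, r) ∈ Ω) (hr : 0 < r) : ∀ᶠ s in 𝓝[>] (0 : ℝ), (t, s) ∈ Ω ∧ 0 < s := by
  filter_upwards [Ioo_mem_nhdsGT hr] with s hs
  exact ⟨hΩ.reaches_center t r s hx hs.1.le hs.2.le, hs.1⟩

theorem IsRadialRegion.tendsto_slice (hΩ : IsRadialRegion Ω) {t r : ℝ}
    (hx : (t, r) ∈ Ω) (hr : 0 < r) :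
    Tendsto (fun s : ℝ => ((t, s) : ℝ × ℝ)) (𝓝[>] 0) (𝓝[Ω] (t, 0)) := by
  refine tendsto_nhdsWithin_iff.2 ⟨?_, (hΩ.eventually_mem_slice hx hr).mono fun s hs => hs.1⟩
  exact ((hasDerivAt_prod_snd t 0).continuousAt.tendsto).mono_left nhdsWithin_le_nhds

section Limits

variable {E : Type*} [NormedAddCommGroup E] [NormedSpace ℝ E] {F : ℝ → ℝ → E} {t r : ℝ}

theorem IsRadialRegion.tendsto_center (hΩ : IsRadialRegion Ω)
    (hF : ContDiffOn ℝ 2 (Function.uncurry F) Ω) (hx : (t, r) ∈ Ω) (hr : 0 < r) :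
    Tendsto (fun s => F t s) (𝓝[>] 0) (𝓝 (F t 0)) :=
  (hF.continuousOn (t, 0) (hΩ.reaches_center t r 0 hx le_rfl hr.le)).tendsto.comp
    (hΩ.tendsto_slice hx hr)

/-- For `r > 0` the ordinary derivative is the derivative within Ω, which is continuous up to the
centre. -/
theorem IsRadialRegion.tendsto_fderiv_center (hΩ : IsRadialRegion Ω)
    (hF : ContDiffOn ℝ 2 (Function.uncurry F) Ω) (hx : (t, r) ∈ Ω) (hr : 0 < r) (v : ℝ × ℝ) :
    Tendsto (fun s => fderiv ℝ (Function.uncurry F) (t, s) v) (𝓝[>] 0)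
      (𝓝 (fderivWithin ℝ (Function.uncurry F) Ω (t, 0) v)) := by
  have hc := hF.continuousOn_fderivWithin hΩ.uniqueDiffOn one_le_two
  have h1 := (hc (t, 0) (hΩ.reaches_center t r 0 hx le_rfl hr.le)).tendsto.comp
    (hΩ.tendsto_slice hx hr)
  refine (((ContinuousLinearMap.apply ℝ E v).continuous.tendsto _).comp h1).congr' ?_
  filter_upwards [hΩ.eventually_mem_slice hx hr] with s hs
  have hm : Ω ∈ 𝓝 (t, s) :=
    mem_of_superset (hΩ.isOpen_pos.mem_nhds ⟨hs.1, hs.2⟩) inter_subset_left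
  simp [fderivWithin_of_mem_nhds hm]

theorem IsRadialRegion.tendsto_dt_center (hΩ : IsRadialRegion Ω)
    (hF : ContDiffOn ℝ 2 (Function.uncurry F) Ω) (hx : (t, r) ∈ Ω) (hr : 0 < r) :
    Tendsto (fun s => dt F t s) (𝓝[>] 0)
      (𝓝 (fderivWithin ℝ (Function.uncurry F) Ω (t, 0) (1, 0))) := by
  refine (hΩ.tendsto_fderiv_center hF hx hr (1, 0)).congr' ?_
  filter_upwards [hΩ.eventually_mem_slice hx hr] with s hs
  exact (dt_eq_fderiv (((hF.mono inter_subset_left).contDiffAt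
    (hΩ.isOpen_pos.mem_nhds ⟨hs.1, hs.2⟩)).differentiableAt two_ne_zero)).symm

theorem IsRadialRegion.tendsto_dr_center (hΩ : IsRadialRegion Ω)
    (hF : ContDiffOn ℝ 2 (Function.uncurry F) Ω) (hx : (t, r) ∈ Ω) (hr : 0 < r) :
    Tendsto (fun s => dr F t s) (𝓝[>] 0)
      (𝓝 (fderivWithin ℝ (Function.uncurry F) Ω (t, 0) (0, 1))) := by
  refine (hΩ.tendsto_fderiv_center hF hx hr (0, 1)).congr' ?_
  filter_upwards [hΩ.eventually_mem_slice hx hr] with s hs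
  exact (dr_eq_fderiv (((hF.mono inter_subset_left).contDiffAt
    (hΩ.isOpen_pos.mem_nhds ⟨hs.1, hs.2⟩)).differentiableAt two_ne_zero)).symm

end Limits

variable {μ₀ Υ : ℝ} {f : ℝ → ℝ → ℂ} {V M : ℝ → ℝ → ℝ} {t r : ℝ}

/-- `M` vanishes along the line `r = 0`, and `(1, 0)` is tangent to it. -/
theorem IsAdmissible.fderivWithin_mass_center_fst (h : IsAdmissible Ω f V M)
    (hΩ : IsRadialRegion Ω) (hx : (t, 0) ∈ Ω) :
    fderivWithin ℝ (Function.uncurry M) Ω (t, 0) (1, 0) = 0 := by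
  obtain ⟨U, hU, hΩU⟩ := hΩ.relatively_open
  have hev : ∀ᶠ s in 𝓝 t, (s, (0 : ℝ)) ∈ Ω := by
    filter_upwards [eventually_mem_fst hU (hΩU ▸ hx : (t, (0 : ℝ)) ∈ U ∩ _).1] with s hs
    rw [hΩU]
    exact ⟨hs, le_refl (0 : ℝ)⟩
  have hd := ((h.M_contDiff (t, 0) hx).differentiableWithinAt two_ne_zero).hasFDerivWithinAt
  have h1 : HasDerivWithinAt (fun s => M s 0)
      (fderivWithin ℝ (Function.uncurry M) Ω (t, 0) (1, 0)) {s | (s, (0 : ℝ)) ∈ Ω} t :=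
    HasFDerivWithinAt.comp_hasDerivWithinAt (l := Function.uncurry M) (f := fun s => (s, 0)) t hd
      (hasDerivAt_prod_fst t 0).hasDerivWithinAt fun s hs => hs
  have h2 := h1.hasDerivAt hev
  exact h2.unique ((hasDerivAt_const t (0 : ℝ)).congr_of_eventuallyEq
    (hev.mono fun s hs => h.M_center s hs))

theorem IsAdmissible.tendsto_mass_div (h : IsAdmissible Ω f V M) (hΩ : IsRadialRegion Ω)
    (hx : (t, r) ∈ Ω) (hr : 0 < r) :
    Tendsto (fun s => M t s / s) (𝓝[>] 0)
      (𝓝 (fderivWithin ℝ (Function.uncurry M) Ω (t, 0) (0, 1))) := by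
  have h0 := hΩ.reaches_center t r 0 hx le_rfl hr.le
  have hd := ((h.M_contDiff (t, 0) h0).differentiableWithinAt two_ne_zero).hasFDerivWithinAt
  have h1 : HasDerivWithinAt (fun s => M t s)
      (fderivWithin ℝ (Function.uncurry M) Ω (t, 0) (0, 1)) (Ioc 0 r) 0 :=
    HasFDerivWithinAt.comp_hasDerivWithinAt (l := Function.uncurry M) (f := fun s => (t, s)) 0 hd
      (hasDerivAt_prod_snd t 0).hasDerivWithinAt
      fun s hs => hΩ.reaches_center t r s hx hs.1.le hs.2
  -- Since `M(t,0) = 0`, the difference quotient at the centre is `M/s`. The interval `Ioc 0 r`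
  -- omits the base point, as the slope criterion requires.
  rw [hasDerivWithinAt_iff_tendsto_slope' (by simp), nhdsWithin_Ioc_eq_nhdsGT hr] at h1
  refine h1.congr fun s => ?_
  rw [slope_def_field, h.M_center t h0, sub_zero, sub_zero]

/-- `M/r` tends to zero at the centre. -/
theorem IsAdmissible.tendsto_mass_div_zero (h : IsAdmissible Ω f V M) (hΥ : Υ ≠ 0)
    (hΩ : IsRadialRegion Ω) (hs : SolvesReducedEKG μ₀ Υ Ω f V M) (hx : (t, r) ∈ Ω) (hr : 0 < r) :
    Tendsto (fun s => M t s / s) (𝓝[>] 0) (𝓝 0) := by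
  have hM := h.tendsto_mass_div hΩ hx hr
  have hMr := hΩ.tendsto_dr_center h.M_contDiff hx hr
  have hf := (hΩ.tendsto_center h.f_contDiff hx hr).norm.pow 2
  have hft := (hΩ.tendsto_dt_center h.f_contDiff hx hr).norm.pow 2
  have hfr := (hΩ.tendsto_dr_center h.f_contDiff hx hr).norm.pow 2
  have hV := ((hΩ.tendsto_center h.V_contDiff hx hr).const_mul 2).rexp
  have hid : Tendsto (fun s : ℝ => s ^ 2) (𝓝[>] 0) (𝓝 0) := by
    simpa using ((continuous_pow 2 (M := ℝ)).tendsto 0).mono_left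
      (nhdsWithin_le_nhds (s := Ioi (0 : ℝ)))
  have hlim := (hid.const_mul (4 * Real.pi * μ₀ / Υ ^ 2)).mul (((hf.const_mul (Υ ^ 2)).add
    (((hM.const_mul 2).const_sub 1).mul hfr)).add (hft.mul (hV.inv₀ (Real.exp_ne_zero _))))
  rw [mul_zero, zero_mul] at hlim
  -- The limit of `M/s` is also the limit of `M_r`, and the mass equation reads `M_r = k s² (Υ²|f|²
  -- + (1 - 2M/s)|f_r|² + e^{-2V}|f_t|²)` with a convergent bracket. The bound `2M < r` alone would
  -- only give a limit at most `1/2`, which does not keep `1 - 2M/r` away from zero.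
  have hzero : fderivWithin ℝ (Function.uncurry M) Ω (t, 0) (0, 1) = 0 := by
    refine tendsto_nhds_unique (hMr.congr' ?_) hlim
    filter_upwards [hΩ.eventually_mem_slice hx hr] with s hsΩ
    obtain ⟨hn1, hn2, hn3⟩ := h.sq_norms hΩ.isOpen_pos hsΩ.1 hsΩ.2
    have hA : 1 - 2 * (M t s / s) = (Real.exp (2 * radialExponent M t s))⁻¹ := by
      rw [h.exp_radialExponent hsΩ.1 hsΩ.2, inv_inv, mul_div_assoc]
    have hmass := hs.mass_eq t s ⟨hsΩ.1, hsΩ.2⟩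
    rw [← hn1, ← hn2, ← hn3] at hmass
    have n1 := Real.exp_ne_zero (2 * radialExponent M t s)
    have n2 := Real.exp_ne_zero (2 * V t s)
    have n3 := hsΩ.2.ne'
    rw [h.dr_mass hΩ.isOpen_pos hsΩ.1 hsΩ.2, hA, hmass]
    field_simp
    ring
  rwa [hzero] at hM

/-- The weighted defect `Z` is constant along each slice and tends to zero at the centre; its weight
is positive for `r > 0`, so the defect vanishes. It is here that slices reaching the centre and
regularity there are essential. -/
theorem IsAdmissible.momentumConstraint (h : IsAdmissible Ω f V M) (hΥ : Υ ≠ 0)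
    (hΩ : IsRadialRegion Ω) (hs : SolvesReducedEKG μ₀ Υ Ω f V M) :
    MomentumConstraint μ₀ Υ Ω f M := by
  rintro t r ⟨hx, hr⟩
  replace hr : 0 < r := hr
  have hU := hΩ.isOpen_pos
  have hfU : ContDiffOn ℝ 2 (Function.uncurry f) (Ω ∩ {q | 0 < q.2}) :=
    h.f_contDiff.mono inter_subset_left
  set k := 4 * Real.pi * μ₀ / Υ ^ 2 with hk
  set Z : ℝ → ℝ := fun s => s * Real.exp (V t s - radialExponent M t s) *
    (dt (radialExponent M) t s - 2 * k * s * (dt (rePart f) t s * dr (rePart f) t s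
      + dt (imPart f) t s * dr (imPart f) t s)) with hZ
  have hZ' : ∀ s, 0 < s → s ≤ r → HasDerivAt Z 0 s := fun s hs0 hsr =>
    SolvesReduced.hasDerivAt_momentum_defect hs hU (fun _ _ hy => hy.2.ne')
      (contDiffOn_rePart hfU) (contDiffOn_imPart hfU) (h.V_contDiff.mono inter_subset_left)
      h.contDiffOn_radialExponent ⟨hΩ.reaches_center t r s hx hs0.le hsr, hs0⟩
  have hconst : ∀ s ∈ Ioo 0 r, Z r = Z s := fun s hs0 =>
    constant_of_has_deriv_right_zero
      (fun y hy => (hZ' y (hs0.1.trans_le hy.1) hy.2).continuousAt.continuousWithinAt)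
      (fun y hy => (hZ' y (hs0.1.trans_le hy.1) hy.2.le).hasDerivWithinAt) r ⟨hs0.2.le, le_rfl⟩
  have hu := h.f_contDiff
  have hre : ContDiffOn ℝ 2 (Function.uncurry (rePart f)) Ω := contDiffOn_rePart hu
  have him : ContDiffOn ℝ 2 (Function.uncurry (imPart f)) Ω := contDiffOn_imPart hu
  have hid : Tendsto (fun s : ℝ => s ^ 2) (𝓝[>] 0) (𝓝 0) := by
    simpa using ((continuous_pow 2 (M := ℝ)).tendsto 0).mono_left
      (nhdsWithin_le_nhds (s := Ioi (0 : ℝ)))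
  have hA : Tendsto (fun s => Real.sqrt (1 - 2 * (M t s / s))) (𝓝[>] 0) (𝓝 1) := by
    simpa using (((h.tendsto_mass_div_zero hΥ hΩ hs hx hr).const_mul 2).const_sub 1).sqrt
  have hMt := hΩ.tendsto_dt_center h.M_contDiff hx hr
  rw [h.fderivWithin_mass_center_fst hΩ (hΩ.reaches_center t r 0 hx le_rfl hr.le)] at hMt
  have hV := (hΩ.tendsto_center h.V_contDiff hx hr).rexp
  have hX := ((hΩ.tendsto_dt_center hre hx hr).mul (hΩ.tendsto_dr_center hre hx hr)).add
    ((hΩ.tendsto_dt_center him hx hr).mul (hΩ.tendsto_dr_center him hx hr))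
  -- With `A = 1 - 2M/s` and `X = Re(f_t f̄_r)`, `Z = e^V (A^{-1/2} M_t - 2k s² A^{1/2} X)`. Every
  -- factor has a limit, `A → 1`, and both `M_t` and `s²` tend to zero.
  have hlim := hV.mul (((hA.inv₀ one_ne_zero).mul hMt).sub
    (((hid.const_mul (2 * k)).mul hA).mul hX))
  simp only [mul_zero, zero_mul, sub_zero] at hlim
  have hZr : Z r = 0 := by
    refine tendsto_nhds_unique (tendsto_const_nhds.congr' ?_) hlim
    filter_upwards [Ioo_mem_nhdsGT hr, hΩ.eventually_mem_slice hx hr] with s hs0 hsΩ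
    have n1 := Real.exp_ne_zero (radialExponent M t s)
    have hsqrt : Real.sqrt (1 - 2 * (M t s / s)) = (Real.exp (radialExponent M t s))⁻¹ := by
      rw [← mul_div_assoc, h.sqrt_eq hsΩ.1 hsΩ.2]
    rw [hconst s hs0, hZ]
    simp only
    rw [h.dt_mass hU hsΩ.1 hsΩ.2, hsqrt, Real.exp_sub, two_mul (radialExponent M t s),
      Real.exp_add]
    field_simp
  rcases mul_eq_zero.1 hZr with h1 | h1
  · exact absurd h1 (mul_ne_zero hr.ne' (Real.exp_ne_zero _))
  · exact sub_eq_zero.1 h1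

end Centre

end SphericalEKG


/-! ### The main theorem -/

theorem mainTheorem4 (μ₀ Υ : ℝ) (hΥ : Υ ≠ 0)
    (Ω : Set (ℝ × ℝ)) (hΩ : SphericalEKG.IsRadialRegion Ω)
    (f p : ℝ → ℝ → ℂ) (V M : ℝ → ℝ → ℝ) (hfVM : SphericalEKG.IsAdmissible Ω f V M) :
    (SphericalEKG.SolvesSystem μ₀ Υ Ω f p V M ↔
      SphericalEKG.SolvesEKG μ₀ Υ Ω f V M ∧ SphericalEKG.IsMomentumOf Ω f p V M) ∧
    ∀ (t₀ : ℝ) (D : SphericalEKG.InitialData), D.IsConsistent μ₀ Υ Ω t₀ →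
      ((SphericalEKG.SolvesSystem μ₀ Υ Ω f p V M ∧ D.AttainedBy Ω t₀ f p V M) ↔
        (SphericalEKG.SolvesEKG μ₀ Υ Ω f V M ∧ SphericalEKG.IsMomentumOf Ω f p V M ∧
          D.CauchyAttainedBy Ω t₀ f V M)) := by
  have main : SphericalEKG.SolvesSystem μ₀ Υ Ω f p V M ↔
      SphericalEKG.SolvesEKG μ₀ Υ Ω f V M ∧ SphericalEKG.IsMomentumOf Ω f p V M := by
    -- The momentum constraint is the only difference between the two sides, and it follows from the
    -- reduced equations.
    rw [hfVM.solvesSystem_iff hΥ hΩ.isOpen_pos, hfVM.solvesEKG_iff hΥ hΩ.isOpen_pos,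
      and_iff_left_of_imp (hfVM.momentumConstraint hΥ hΩ)]
  refine ⟨main, fun t₀ D _ => ?_⟩
  rw [main, and_assoc, and_congr_right_iff]
  refine fun _ => and_congr_right fun hp => forall₃_congr fun r hx hr => ?_
  -- Once `V = V₀` and `M = M₀` on the slice, prescribing `p` is the same as prescribing `f_t`.
  have hev := SphericalEKG.momentum_iff_evolution (z := deriv (fun s => f s r) t₀) (w := D.p₀ r)
    (v := V t₀ r) (hfVM.one_sub_pos hx hr)
  refine and_congr_right fun _ => ?_
  constructor
  · rintro ⟨h2, h3, h4⟩
    refine ⟨?_, h3, h4⟩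
    rw [← h3, ← h4]
    exact hev.2 (h2.symm.trans (hp t₀ r hx hr))
  · rintro ⟨h2, h3, h4⟩
    rw [← h3, ← h4] at h2
    exact ⟨(hp t₀ r hx hr).trans (hev.1 h2).symm, h3, h4⟩
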